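/- This holds in ZFC. "Group" means abelian group. A group $C$ is \emph{cotorsion} if $\operatorname{Ext}(G,C)=0$ for all torsion-free groups $G$, and a group is \emph{$\aleph_k$-free} if each of its subgroups of cardinality $<\aleph_k$ is free. Let $k\ge 2$ be an integer and let $\lambda_1,\dots,\lambda_k$ be infinite cardinals with $\lambda_1=\lambda_1^{\aleph_0}$ and $\lambda_{i+1}=2^{\lambda_i}$ for $1\le i<k$. Then there exists an $\aleph_k$-free group $F$ of cardinality $|F|=\lambda_k$ such that for every group $C$ of cardinality $|C|\le\lambda_1$ the following are equivalent: (i) $C$ is cotorsion; (ii) $\operatorname{Ext}(F,C)=0$. Moreover, $F$ can be chosen to be (isomorphic to) the direct sum $\bigoplus_{D\in\mathcal D}F_D$, where $\mathcal D$ contains exactly one group of each isomorphism type of non-cotorsion groups of cardinality $\le\lambda_1$, and each $F_D$ is the following group, which depends only on $\lambda_1,\dots,\lambda_k$. Let $\Lambda$ be the set of all tuples $\bar\eta=(\eta_1,\dots,\eta_k)$ of strictly increasing functions $\eta_m:\omega\to\lambda_m$. Let $\Lambda_*$ be the set of all tuples obtained in the same way, except that exactly one entry, say the $m$-th, is a strictly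 increasing function $n\to\lambda_m$ with $n<\omega$. For $\bar\eta\in\Lambda$ let $\bar\eta\upharpoonright\langle m,n\rangle\in\Lambda_*$ arise from $\bar\eta$ by replacing $\eta_m$ with $\eta_m\upharpoonright n$. Let $B=\bigoplus_{\bar\nu\in\Lambda_*}\mathbb Z e_{\bar\nu}$, with $\mathbb Z$-adic completion $\widehat B$. Then $F_D$ is the subgroup of $\widehat B$ generated by $B$ and all elements $$y_{\bar\eta i}=\sum_{n=i}^{\infty}\frac{n!}{i!}\sum_{m=1}^{k}e_{\bar\eta\upharpoonright\langle m,n\rangle}\qquad(\bar\eta\in\Lambda,\ i<\omega).$$ -/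

import Mathlib

open Cardinal

universe u

/-- `Ext(F, C) = 0`: the group of degree-one extensions of abelian groups (that is, of `ℤ`-modules)
vanishes. -/
def ExtVanishes (F C : Type u) [AddCommGroup F] [AddCommGroup C] : Prop :=
  Subsingleton (CategoryTheory.Abelian.Ext (ModuleCat.of ℤ F) (ModuleCat.of ℤ C) 1)

/-- An abelian group `C` is cotorsion if `Ext(G, C) = 0` for all torsion-free abelian groups `G`. -/
def IsCotorsion (C : Type u) [AddCommGroup C] : Prop :=
  ∀ (G : Type u) [AddCommGroup G], IsAddTorsionFree G → ExtVanishes G C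

/-- An abelian group `G` is `κ`-free if every subgroup of cardinality less than `κ` is free. -/
def IsCardFree (κ : Cardinal.{u}) (G : Type u) [AddCommGroup G] : Prop :=
  ∀ H : AddSubgroup G, #H < κ → Module.Free ℤ H

/-- Strictly increasing sequences of length `ω` of ordinals below the cardinal `κ`. -/
def IncSeq (κ : Cardinal.{u}) : Type u :=
  {η : ℕ → κ.ord.ToType // StrictMono η}

/-- Strictly increasing finite sequences of ordinals below the cardinal `κ`, of length `n`. -/
def FinIncSeq (κ : Cardinal.{u}) (n : ℕ) : Type u :=
  {σ : Fin n → κ.ord.ToType // StrictMono σ}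

/-- The initial segment of length `n` of an increasing sequence. -/
def IncSeq.restrict {κ : Cardinal.{u}} (η : IncSeq κ) (n : ℕ) : FinIncSeq κ n :=
  ⟨fun j => η.1 j, fun _ _ h => η.2 h⟩

/-- The set `Λ` of tuples `(η₁, …, η_k)`, where `η_m` is an increasing `ω`-sequence in `κ_m`. -/
def BranchTuple {k : ℕ} (κ : Fin k → Cardinal.{u}) : Type u :=
  ∀ m : Fin k, IncSeq (κ m)

/-- The set `Λ_*` of tuples in which exactly one entry (the `m`-th one) is a finite increasing
sequence, of length `n`, in `κ_m`, while each other entry is an increasing `ω`-sequence. -/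
structure NodeTuple {k : ℕ} (κ : Fin k → Cardinal.{u}) : Type u where
  m : Fin k
  n : ℕ
  short : FinIncSeq (κ m) n
  rest : ∀ l : {l : Fin k // l ≠ m}, IncSeq (κ l)

/-- The tuple `η ↾ ⟨m, n⟩`: the `m`-th entry of `η` is cut down to its first `n` terms. -/
def BranchTuple.cut {k : ℕ} {κ : Fin k → Cardinal.{u}} (η : BranchTuple κ) (m : Fin k) (n : ℕ) :
    NodeTuple κ :=
  ⟨m, n, (η m).restrict n, fun l => η l⟩

open Classical in
/-- The branch element `y_{η,i} = ∑_{n ≥ i} (n! / i!) ∑_m e_{η ↾ ⟨m, n⟩}` in coordinates.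
As `m` and `n` can be read off from `η ↾ ⟨m, n⟩`, each basis vector occurs at most once in this sum;
so all coordinates are integers, and the division is exact. -/
noncomputable def branchElement {k : ℕ} {κ : Fin k → Cardinal.{u}} (η : BranchTuple κ) (i : ℕ) :
    NodeTuple κ → ℤ :=
  fun ν => if i ≤ ν.n ∧ ν = η.cut ν.m ν.n then ((ν.n.factorial / i.factorial : ℕ) : ℤ) else 0

open Classical in
/-- The group generated by all basis vectors `e_ν` (`ν ∈ Λ_*`) and all branch elements. It is a
subgroup of the `ℤ`-adic completion of the free group on `Λ_*`; elements of this completion are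
families of coordinates in the `ℤ`-adic integers, indexed by `Λ_*`, and as all generators have
coordinates in `ℤ`, the group already lives in the product of copies of `ℤ`.
It depends on the cardinals `κ_m` only. -/
noncomputable def branchGroup {k : ℕ} (κ : Fin k → Cardinal.{u}) : AddSubgroup (NodeTuple κ → ℤ) :=
  AddSubgroup.closure
    (Set.range (fun ν : NodeTuple κ => (Pi.single ν 1 : NodeTuple κ → ℤ)) ∪
      Set.range (fun p : BranchTuple κ × ℕ => branchElement p.1 p.2))

/-- `D` is a system of representatives, containing exactly one group of each isomorphism type, of
the abelian groups of cardinality at most `μ` that are not cotorsion. -/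
structure IsNonCotorsionSystem (μ : Cardinal.{u}) {ι : Type u} (D : ι → Type u)
    [∀ i, AddCommGroup (D i)] : Prop where
  card_le : ∀ i, #(D i) ≤ μ
  not_cotorsion : ∀ i, ¬ IsCotorsion (D i)
  exhaustive : ∀ (C : Type u) [AddCommGroup C], #C ≤ μ → ¬ IsCotorsion C →
    ∃ i, Nonempty (C ≃+ D i)
  irredundant : ∀ i j, Nonempty (D i ≃+ D j) → i = j

/-! ### Ext through divisible resolutions -/

section Resolution

/-! The group `C` is cotorsion iff every system `z_i - (i + 1) z_{i+1} = c_i` is solvable in `C`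
(`isCotorsion_iff_factorialSolvable`): torsion-free groups embed in rational vector spaces, and `ℚ`
is generated by the elements `1 / i!`. The branch elements satisfy `y_{η,i} - (i + 1) y_{η,i+1} =
∑_m e_{η ↾ ⟨m, i⟩}`. If `Ext(branchGroup κ, C) = 0`, then for all prescribed `c_{η,i}` there are a
homomorphism `x` on the finitely supported part and `z_{η,i}` with `z_{η,i} - (i + 1) z_{η,i+1} =
∑_m x(e_{η ↾ ⟨m, i⟩}) + c_{η,i}` (`ExtVanishes.exists_solution`). To solve a system `d`, let
`c_{η,i}` be `d_i` minus a guess of that sum. By `exists_prediction` some branch guesses right, and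
there `z_η` solves the system. The prediction needs `λ_m` to bound the number of functions from the
lower coordinates to `C`, whence the powers `2 ^ λ_i`. Freeness comes from
`hasDistinguishedCuts_of_mk_le`: for at most `ℵ_{k-1}` branches, the `k` coordinates suffice to give
each branch a coordinate whose late cuts avoid the other branches of no larger rank. Exchanging
these cuts for branch elements yields a basis. The summands `F_D` do not depend on `D`, so one of
them already tests every `C`; the index set only has to be nonempty and of size at most `λ_k`. -/

theorem Module.Baer.exists_nsmul_eq {D : Type*} [AddCommGroup D] (hD : Module.Baer ℤ D)
    {n : ℕ} (hn : n ≠ 0) (d : D) : ∃ d' : D, n • d' = d := by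
  obtain ⟨h, hh⟩ := hD.extension_property_addMonoidHom (nsmulAddMonoidHom (α := ℤ) n)
    (fun a b hab => by simpa [hn] using hab) (zmultiplesHom D d)
  refine ⟨h 1, ?_⟩
  rw [← map_nsmul]
  exact (DFunLike.congr_fun hh 1).trans (one_smul ℤ d)

theorem Module.Baer.of_exists_nsmul_eq {D : Type*} [AddCommGroup D]
    (h : ∀ n : ℕ, n ≠ 0 → ∀ d : D, ∃ d' : D, n • d' = d) : Module.Baer ℤ D := by
  have h' : ∀ n : ℤ, n ≠ 0 → ∀ d : D, ∃ d' : D, n • d' = d := by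
    intro n hn d
    obtain ⟨d', hd'⟩ := h n.natAbs (by simpa using hn) d
    rcases Int.natAbs_eq n with h1 | h1
    · exact ⟨d', by rw [h1, natCast_zsmul, hd']⟩
    · exact ⟨-d', by rw [h1, neg_smul, smul_neg, neg_neg, natCast_zsmul, hd']⟩
  choose! div hdiv using h'
  classical
  let : DivisibleBy D ℤ :=
    { div := fun d n => if n = 0 then 0 else div n d
      div_zero := fun d => by simp
      div_cancel := fun {n} d hn => by simp [hn, hdiv n hn d] }
  exact Module.Baer.of_divisible D

/-- Every abelian group embeds in a divisible one. -/
theorem exists_divisible_embedding (C : Type u) [AddCommGroup C] :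
    ∃ (D : Type u) (_ : AddCommGroup D) (j : C →+ D),
      Function.Injective j ∧ Module.Baer ℤ D := by
  let E := CategoryTheory.Injective.under (ModuleCat.of ℤ C)
  refine ⟨E, inferInstance, (CategoryTheory.Injective.ι (ModuleCat.of ℤ C)).hom.toAddMonoidHom,
    (ModuleCat.mono_iff_injective (CategoryTheory.Injective.ι (ModuleCat.of ℤ C))).1 inferInstance,
    ?_⟩
  have : CategoryTheory.Injective (ModuleCat.of ℤ E) :=
    inferInstanceAs (CategoryTheory.Injective E)
  have hE := Module.Baer.of_injective (Module.injective_module_of_injective_object ℤ E)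
  -- The module structure carried by `E` and the canonical one of its additive group agree, as
  -- `ℤ`-module structures are unique.
  convert hE
  exact Subsingleton.elim _ _

theorem Module.Baer.of_surjective {D A : Type*} [AddCommGroup D] [AddCommGroup A]
    (hD : Module.Baer ℤ D) (π : D →+ A) (hπ : Function.Surjective π) : Module.Baer ℤ A := by
  refine Module.Baer.of_exists_nsmul_eq fun n hn a => ?_
  obtain ⟨d, rfl⟩ := hπ a
  obtain ⟨d', rfl⟩ := hD.exists_nsmul_eq hn d
  exact ⟨π d', (map_nsmul π n d').symm⟩

open CategoryTheory CategoryTheory.Abelian in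
/-- `Ext(G, C)` measures the failure of lifting along `D → D / C` when `D` is divisible. -/
theorem extVanishes_iff_forall_lift {G C D A : Type u} [AddCommGroup G] [AddCommGroup C]
    [AddCommGroup D] [AddCommGroup A] (j : C →+ D) (π : D →+ A) (hj : Function.Injective j)
    (hπ : Function.Surjective π) (hjπ : Function.Exact j π) (hD : Module.Baer ℤ D) :
    ExtVanishes G C ↔ ∀ ψ : G →+ A, ∃ Ψ : G →+ D, π.comp Ψ = ψ := by
  let S : ShortComplex (ModuleCat.{u} ℤ) :=
    ShortComplex.mk (ModuleCat.ofHom j.toIntLinearMap) (ModuleCat.ofHom π.toIntLinearMap)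
      (by ext x; exact (hjπ (j x)).2 ⟨x, rfl⟩)
  have hS : S.ShortExact := ModuleCat.shortComplex_shortExact S hjπ hj hπ
  have : Injective S.X₂ := by
    have := hD.injective
    exact Module.injective_object_of_injective_module ℤ D
  unfold ExtVanishes
  constructor
  · intro hsub ψ
    obtain ⟨x₂, hx₂⟩ := Ext.covariant_sequence_exact₃ (ModuleCat.of ℤ G) hS
      (Ext.mk₀ (ModuleCat.ofHom ψ.toIntLinearMap)) (zero_add 1) (hsub.elim _ _)
    obtain ⟨f, rfl⟩ := Ext.homEquiv₀.symm.surjective x₂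
    rw [Ext.homEquiv₀_symm_apply, Ext.mk₀_comp_mk₀] at hx₂
    have h := (Ext.mk₀_bijective _ _).1 hx₂
    refine ⟨f.hom.toAddMonoidHom, ?_⟩
    ext x
    exact congrArg (fun g => g.hom x) h
  · intro hl
    refine subsingleton_of_forall_eq 0 fun x => ?_
    obtain ⟨x₃, rfl⟩ := Ext.covariant_sequence_exact₁ (ModuleCat.of ℤ G) hS x
      (Ext.eq_zero_of_injective _) (zero_add 1)
    obtain ⟨f, rfl⟩ := Ext.homEquiv₀.symm.surjective x₃
    obtain ⟨Ψ, hΨ⟩ := hl f.hom.toAddMonoidHom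
    have : f = ModuleCat.ofHom Ψ.toIntLinearMap ≫ S.g := by
      ext x
      exact (DFunLike.congr_fun hΨ x).symm
    rw [Ext.homEquiv₀_symm_apply, this, ← Ext.mk₀_comp_mk₀, Ext.comp_assoc _ _ _ rfl (zero_add 1) rfl,
      hS.comp_extClass, Ext.comp_zero]

/-- A divisible embedding together with its quotient. -/
theorem exists_divisible_resolution (C : Type u) [AddCommGroup C] :
    ∃ (D A : Type u) (_ : AddCommGroup D) (_ : AddCommGroup A) (j : C →+ D) (π : D →+ A),
      Function.Injective j ∧ Function.Surjective π ∧ Function.Exact j π ∧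
      Module.Baer ℤ D ∧ Module.Baer ℤ A := by
  obtain ⟨D, _, j, hj, hD⟩ := exists_divisible_embedding C
  refine ⟨D, D ⧸ j.range, inferInstance, inferInstance, j, QuotientAddGroup.mk' _, hj,
    QuotientAddGroup.mk'_surjective _, fun x => ?_, hD,
    hD.of_surjective _ (QuotientAddGroup.mk'_surjective _)⟩
  simp

theorem ExtVanishes.of_retract {F G C : Type u} [AddCommGroup F] [AddCommGroup G]
    [AddCommGroup C] (i : G →+ F) (p : F →+ G) (hpi : p.comp i = AddMonoidHom.id G)
    (h : ExtVanishes F C) : ExtVanishes G C := by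
  obtain ⟨D, A, _, _, j, π, hj, hπ, hjπ, hD, -⟩ := exists_divisible_resolution C
  rw [extVanishes_iff_forall_lift j π hj hπ hjπ hD] at h ⊢
  intro ψ
  obtain ⟨Ψ, hΨ⟩ := h (ψ.comp p)
  exact ⟨Ψ.comp i, by rw [← AddMonoidHom.comp_assoc, hΨ, AddMonoidHom.comp_assoc, hpi,
    AddMonoidHom.comp_id]⟩

/-- Quotients of divisible groups are divisible, so a map `G → A` extends to `F`, lifts there, and
restricts back. -/
theorem ExtVanishes.of_injective {F G C : Type u} [AddCommGroup F] [AddCommGroup G]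
    [AddCommGroup C] (i : G →+ F) (hi : Function.Injective i)
    (h : ExtVanishes F C) : ExtVanishes G C := by
  obtain ⟨D, A, _, _, j, π, hj, hπ, hjπ, hD, hA⟩ := exists_divisible_resolution C
  rw [extVanishes_iff_forall_lift j π hj hπ hjπ hD] at h ⊢
  intro ψ
  obtain ⟨ψ', hψ'⟩ := hA.extension_property_addMonoidHom i hi ψ
  obtain ⟨Ψ, hΨ⟩ := h ψ'
  exact ⟨Ψ.comp i, by rw [← AddMonoidHom.comp_assoc, hΨ, hψ']⟩

end Resolution

/-! ### Factorial chains and the equations forced by vanishing Ext -/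

section FactorialChain

/-- A family of sequences with `y_{j,i} = (i + 1) y_{j,i+1}`. -/
def IsFactorialChain {J Y : Type*} [AddCommGroup Y] (y : J → ℕ → Y) : Prop :=
  ∀ j i, y j i = (i + 1) • y j (i + 1)

theorem IsFactorialChain.linearCombination_succ {J Y : Type*} [AddCommGroup Y] {y : J → ℕ → Y}
    (hy : IsFactorialChain y) (N : ℕ) (b : J →₀ ℤ) :
    Finsupp.linearCombination ℤ (fun j => y j N) b =
      Finsupp.linearCombination ℤ (fun j => y j (N + 1)) ((N + 1) • b) := by
  have h : (fun j => y j N) = fun j => (N + 1) • y j (N + 1) := funext fun j => hy j N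
  rw [h, map_nsmul, Finsupp.linearCombination_apply, Finsupp.linearCombination_apply,
    Finsupp.smul_sum]
  exact Finsupp.sum_congr fun j _ => smul_comm _ _ _

/-- The pairs of corresponding integral combinations of two factorial chains. -/
def factorialGraph {J Y A : Type*} [AddCommGroup Y] [AddCommGroup A] (y : J → ℕ → Y)
    (t : J → ℕ → A) : Submodule ℤ (Y × A) where
  carrier := {p | ∃ N₀, ∀ N ≥ N₀, ∃ b : J →₀ ℤ,
    p.1 = Finsupp.linearCombination ℤ (fun j => y j N) b ∧
    p.2 = Finsupp.linearCombination ℤ (fun j => t j N) b}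
  zero_mem' := ⟨0, fun N _ => ⟨0, by simp, by simp⟩⟩
  add_mem' := by
    rintro p q ⟨N₀, hp⟩ ⟨N₁, hq⟩
    refine ⟨max N₀ N₁, fun N hN => ?_⟩
    obtain ⟨b, hb1, hb2⟩ := hp N (le_trans (le_max_left _ _) hN)
    obtain ⟨b', hb1', hb2'⟩ := hq N (le_trans (le_max_right _ _) hN)
    exact ⟨b + b', by simp [hb1, hb1'], by simp [hb2, hb2']⟩
  smul_mem' := by
    rintro c p ⟨N₀, hp⟩
    refine ⟨N₀, fun N hN => ?_⟩
    obtain ⟨b, hb1, hb2⟩ := hp N hN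
    exact ⟨c • b, by simp [hb1], by simp [hb2]⟩

/-- An independent factorial chain maps to every factorial chain in a divisible group. -/
theorem IsFactorialChain.exists_hom {J Y A : Type*} [AddCommGroup Y] [AddCommGroup A]
    {y : J → ℕ → Y} {t : J → ℕ → A} (hy : IsFactorialChain y) (ht : IsFactorialChain t)
    (hind : ∀ N, LinearIndependent ℤ (fun j => y j N)) (hA : Module.Baer ℤ A) :
    ∃ f : Y →+ A, ∀ j i, f (y j i) = t j i := by
  -- Independence at a single level makes the relation single-valued; divisibility of `A` then
  -- extends the resulting partial map to `Y`.
  have hfun : ∀ p ∈ factorialGraph y t, p.1 = 0 → p.2 = 0 := by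
    rintro p ⟨N, hp⟩ h0
    obtain ⟨b, hb1, hb2⟩ := hp N le_rfl
    have : b = 0 := linearIndependent_iff.1 (hind N) b (hb1.symm.trans h0)
    simpa [this] using hb2
  let φ := (factorialGraph y t).toLinearPMap
  obtain ⟨f, hf⟩ := hA.extension_property φ.domain.subtype Subtype.val_injective φ.toFun
  refine ⟨f.toAddMonoidHom, fun j i => ?_⟩
  have hmem : (y j i, t j i) ∈ factorialGraph y t := by
    refine ⟨i, fun N hN => ?_⟩
    induction N, hN using Nat.le_induction with
    | base => exact ⟨Finsupp.single j 1, by simp, by simp⟩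
    | succ N _ ih =>
      obtain ⟨b, hb1, hb2⟩ := ih
      exact ⟨(N + 1) • b, by rw [← hy.linearCombination_succ, hb1],
        by rw [← ht.linearCombination_succ, hb2]⟩
  have hdom : y j i ∈ φ.domain := ⟨_, hmem, rfl⟩
  have h1 : f (y j i) = φ ⟨y j i, hdom⟩ := LinearMap.congr_fun hf ⟨y j i, hdom⟩
  have h2 : (y j i, φ ⟨y j i, hdom⟩) ∈ factorialGraph y t :=
    Submodule.mem_graph_toLinearPMap hfun ⟨y j i, hdom⟩
  have h3 := hfun _ (sub_mem hmem h2) (by simp)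
  change f (y j i) = t j i
  rw [h1]
  exact (sub_eq_zero.1 h3).symm

/-- If `Ext(X, C) = 0` then the equations coming from a factorial chain modulo `ker q` are
solvable in `C` for all right-hand sides. -/
theorem ExtVanishes.exists_solution {X C : Type u} [AddCommGroup X] [AddCommGroup C]
    (hX : ExtVanishes X C) {J Y : Type*} [AddCommGroup Y] (q : X →+ Y) (y : J → ℕ → X)
    (hy : IsFactorialChain fun j i => q (y j i))
    (hind : ∀ N, LinearIndependent ℤ (fun j => q (y j N))) (c : J → ℕ → C) :
    ∃ (x : q.ker →+ C) (z : J → ℕ → C), ∀ j i (h : y j i - (i + 1) • y j (i + 1) ∈ q.ker),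
      z j i - (i + 1) • z j (i + 1) = x ⟨_, h⟩ + c j i := by
  obtain ⟨D, A, _, _, ι, π, hι, hπ, hιπ, hD, hA⟩ := exists_divisible_resolution C
  rw [extVanishes_iff_forall_lift ι π hι hπ hιπ hD] at hX
  -- In `D` the equations with right-hand side `-c` are solvable by division. Modulo `C` the
  -- solution is a factorial chain, hence the image of `q ∘ y` under some `f`; a lift `Ψ` of `f ∘ q`
  -- gives `x = Ψ` on `ker q` and `z = Ψ y - t`.
  have ht : ∀ j, ∃ t : ℕ → D, ∀ i, t i = (i + 1) • t (i + 1) - ι (c j i) := by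
    intro j
    choose! div hdiv using fun n (hn : n ≠ 0) d => hD.exists_nsmul_eq (n := n) hn d
    let t : ℕ → D := fun i => Nat.rec (0 : D) (fun i d => div (i + 1) (d + ι (c j i))) i
    refine ⟨t, fun i => ?_⟩
    have : t (i + 1) = div (i + 1) (t i + ι (c j i)) := rfl
    rw [this, hdiv _ (Nat.succ_ne_zero i), add_sub_cancel_right]
  choose t ht using ht
  have hπι : ∀ a, π (ι a) = 0 := fun a => (hιπ (ι a)).2 ⟨a, rfl⟩
  obtain ⟨f, hf⟩ := hy.exists_hom (t := fun j i => π (t j i))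
    (fun j i => by simp only []; rw [ht j i, map_sub, hπι, sub_zero, map_nsmul]) hind hA
  obtain ⟨Ψ, hΨ⟩ := hX (f.comp q)
  have hΨ' : ∀ v, π (Ψ v) = f (q v) := fun v => DFunLike.congr_fun hΨ v
  have hx : ∀ b : q.ker, ∃ a, ι a = Ψ b := fun b => (hιπ _).1 (by
    rw [hΨ', show q b = 0 from b.2, map_zero])
  have hz : ∀ j i, ∃ a, ι a = Ψ (y j i) - t j i := fun j i => (hιπ _).1 (by
    rw [map_sub, hΨ', hf, sub_self])
  choose x hx using hx
  choose z hz using hz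
  refine ⟨AddMonoidHom.mk' x fun a b => hι ?_, z, fun j i h => hι ?_⟩
  · rw [map_add, hx, hx, hx, AddSubgroup.coe_add, map_add]
  · rw [map_sub, map_nsmul, map_add, AddMonoidHom.mk'_apply, hx, hz, hz, map_sub, map_nsmul,
      ht j i, smul_sub]
    abel

end FactorialChain

/-! ### Cotorsion groups as those solving factorial systems -/

section Cotorsion

/-- All systems `z_i = (i + 1) z_{i+1} + c_i` are solvable in `C`. -/
def FactorialSolvable (C : Type*) [AddCommGroup C] : Prop :=
  ∀ c : ℕ → C, ∃ z : ℕ → C, ∀ i, z i - (i + 1) • z (i + 1) = c i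

theorem FactorialSolvable.of_equiv {C C' : Type*} [AddCommGroup C] [AddCommGroup C']
    (e : C ≃+ C') (h : FactorialSolvable C) : FactorialSolvable C' := by
  intro c
  obtain ⟨z, hz⟩ := h fun i => e.symm (c i)
  exact ⟨fun i => e (z i), fun i => by rw [← map_nsmul, ← map_sub, hz, e.apply_symm_apply]⟩

theorem isFactorialChain_inv_factorial_smul {J V : Type*} [AddCommGroup V] [Module ℚ V]
    (v : J → V) : IsFactorialChain fun j i => ((i.factorial : ℚ)⁻¹) • v j := by
  intro j i
  have : ((i + 1).factorial : ℚ) ≠ 0 := by positivity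
  rw [← Nat.cast_smul_eq_nsmul ℚ, smul_smul]
  rw [Nat.factorial_succ]
  push_cast
  have h1 : ((i : ℚ) + 1) ≠ 0 := by positivity
  have h2 : (i.factorial : ℚ) ≠ 0 := by positivity
  field_simp

theorem linearIndependent_int_inv_factorial_smul {J V : Type*} [AddCommGroup V] [Module ℚ V]
    {v : J → V} (hv : LinearIndependent ℚ v) (N : ℕ) :
    LinearIndependent ℤ fun j => ((N.factorial : ℚ)⁻¹) • v j := by
  have h : LinearIndependent ℚ fun j => ((N.factorial : ℚ)⁻¹) • v j :=
    hv.units_smul fun _ => Units.mk0 _ (inv_ne_zero (by positivity))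
  exact h.restrict_scalars (by intro a b hab; simpa using hab)

theorem AddMonoidHom.eq_of_eq_on_inv_factorial_smul {J V A : Type*} [AddCommGroup V] [Module ℚ V]
    [AddCommGroup A] (v : Module.Basis J ℚ V) {f g : V →+ A}
    (h : ∀ j i, f (((Nat.factorial i : ℚ)⁻¹) • v j) = g (((Nat.factorial i : ℚ)⁻¹) • v j)) :
    f = g := by
  have key : ∀ j (r : ℚ), f (r • v j) = g (r • v j) := by
    intro j r
    -- Since `den * (den - 1)! = den!`, each rational is an integral multiple of some `1 / i!`.
    have hr : r = (r.num * (r.den - 1).factorial : ℤ) * ((r.den.factorial : ℚ)⁻¹) := by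
      have h1 : r.den * (r.den - 1).factorial = r.den.factorial :=
        Nat.mul_factorial_pred r.den_ne_zero
      rw [← h1]
      have h2 : ((r.den - 1).factorial : ℚ) ≠ 0 := by positivity
      have h3 : (r.den : ℚ) ≠ 0 := by simp
      push_cast
      field_simp
      exact Rat.mul_den_eq_num r
    rw [hr, mul_smul, Int.cast_smul_eq_zsmul, map_zsmul, map_zsmul, h]
  ext x
  rw [← v.linearCombination_repr x, Finsupp.linearCombination_apply, map_finsuppSum,
    map_finsuppSum]
  exact Finsupp.sum_congr fun j _ => key j _

/-- Arbitrary lifts to `D` of the images of `v_j / i!` fail to form a chain only by errors in `C`.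
Solving the system with these errors corrects the lifts to a chain, which defines a map on `V`. -/
theorem FactorialSolvable.extVanishes_of_module_rat {V C : Type u} [AddCommGroup V] [Module ℚ V]
    [AddCommGroup C] (h : FactorialSolvable C) : ExtVanishes V C := by
  obtain ⟨D, A, _, _, ι, π, hι, hπ, hιπ, hD, -⟩ := exists_divisible_resolution C
  rw [extVanishes_iff_forall_lift ι π hι hπ hιπ hD]
  intro ψ
  let v := Module.Basis.ofVectorSpace ℚ V
  have hy := isFactorialChain_inv_factorial_smul v
  choose d hd using fun j i => hπ (ψ (((Nat.factorial i : ℚ)⁻¹) • v j))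
  have hc : ∀ j i, ∃ a, ι a = d j i - (i + 1) • d j (i + 1) := fun j i => (hιπ _).1 (by
    rw [map_sub, map_nsmul, hd, hd, ← map_nsmul, ← map_sub, sub_eq_zero.2 (hy j i), map_zero])
  choose c hc using hc
  choose z hz using fun j => h (c j)
  have ht : IsFactorialChain fun j i => d j i - ι (z j i) := by
    intro j i
    have h1 : ι (z j i) = (i + 1) • ι (z j (i + 1)) + ι (c j i) := by
      rw [← hz j i, map_sub, map_nsmul, add_sub_cancel]
    simp only []
    rw [h1, hc j i, smul_sub]
    abel
  obtain ⟨f, hf⟩ := hy.exists_hom ht (linearIndependent_int_inv_factorial_smul v.linearIndependent)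
    hD
  refine ⟨f, AddMonoidHom.eq_of_eq_on_inv_factorial_smul v fun j i => ?_⟩
  rw [AddMonoidHom.comp_apply, hf, map_sub, hd, (hιπ _).2 ⟨_, rfl⟩, sub_zero]

theorem FactorialSolvable.isCotorsion {C : Type u} [AddCommGroup C] (h : FactorialSolvable C) :
    IsCotorsion C := by
  intro G _ hG
  exact ExtVanishes.of_injective
    (AddMonoidHom.mk' (DivisibleHull.coe : G → DivisibleHull G) fun a b => DivisibleHull.coe_add)
    DivisibleHull.coe_injective h.extVanishes_of_module_rat

/-- Apply `ExtVanishes.exists_solution` to `ℚ`, with the chain `1 / i!` and `q` the identity, so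
that the kernel term vanishes. -/
theorem IsCotorsion.factorialSolvable {C : Type u} [AddCommGroup C] (h : IsCotorsion C) :
    FactorialSolvable C := by
  intro c
  have hX : ExtVanishes (PUnit.{u + 1} →₀ ℚ) C := h _ inferInstance
  let v := Finsupp.basisSingleOne (R := ℚ) (ι := PUnit.{u + 1})
  have hy := isFactorialChain_inv_factorial_smul v
  obtain ⟨x, z, hz⟩ := hX.exists_solution (AddMonoidHom.id _) _ hy
    (linearIndependent_int_inv_factorial_smul v.linearIndependent) fun _ => c
  have hx : ∀ b, x b = 0 := fun b => by
    rw [show b = 0 from Subtype.ext (AddMonoidHom.mem_ker.1 b.2), map_zero]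
  exact ⟨z ⟨⟩, fun i => (hz ⟨⟩ i (sub_eq_zero.2 (hy ⟨⟩ i))).trans (by rw [hx, zero_add])⟩

theorem isCotorsion_iff_factorialSolvable {C : Type u} [AddCommGroup C] :
    IsCotorsion C ↔ FactorialSolvable C :=
  ⟨IsCotorsion.factorialSolvable, FactorialSolvable.isCotorsion⟩

theorem not_factorialSolvable_int : ¬ FactorialSolvable ℤ := by
  intro h
  obtain ⟨z, hz⟩ := h fun _ => 1
  have hz' : ∀ i : ℕ, z i = (i + 1) * z (i + 1) + 1 := fun i => by
    have := hz i
    rw [nsmul_eq_mul] at this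
    push_cast at this
    linarith
  -- Starting at index 2 makes the factor at least 3: once `|z| ≤ 1`, the next term satisfies `3 |z|
  -- ≤ 2` and is 0. Two consecutive zeros contradict the equation.
  have hstep : ∀ i : ℕ, 3 * |z (i + 2 + 1)| ≤ |z (i + 2)| + 1 := fun i => by
    have h1 := hz' (i + 2)
    have h2 : ((i + 2 : ℕ) + 1 : ℤ) * |z (i + 2 + 1)| = |z (i + 2) - 1| := by
      rw [show z (i + 2) - 1 = ((i + 2 : ℕ) + 1 : ℤ) * z (i + 2 + 1) by linarith, abs_mul,
        abs_of_nonneg (show (0 : ℤ) ≤ (i + 2 : ℕ) + 1 by omega)]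
    have h3 : |z (i + 2) - 1| ≤ |z (i + 2)| + 1 := by
      simpa using abs_sub (z (i + 2)) 1
    push_cast at h2
    nlinarith [abs_nonneg (z (i + 2 + 1))]
  have hbound : ∀ i : ℕ, |z (i + 2)| ≤ max 1 (|z 2| - i) := by
    intro i
    induction i with
    | zero => simp
    | succ i ih =>
      have h1 := hstep i
      rw [show i + 1 + 2 = i + 2 + 1 by ring]
      push_cast
      grind
  have hzero : ∀ i : ℕ, |z 2| ≤ i → z (i + 2 + 1) = 0 := fun i hi => by
    have h1 := hstep i
    have h2 := hbound i
    have h3 : max 1 (|z 2| - i) = 1 := max_eq_left (by linarith)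
    exact abs_nonpos_iff.1 (by omega)
  have h1 := hzero (z 2).natAbs (by simp)
  have h2 := hzero ((z 2).natAbs + 1) (by simp)
  have h3 := hz' ((z 2).natAbs + 2 + 1)
  rw [h1, show (z 2).natAbs + 2 + 1 + 1 = (z 2).natAbs + 1 + 2 + 1 by ring, h2] at h3
  simp at h3

end Cotorsion

/-! ### Subgroups of free groups -/

section FreeSubmodule

/-- Submodules of free modules over a principal ideal domain are free, in any rank. -/
theorem Submodule.free_of_free_of_isPrincipalIdealRing {R M : Type*} [CommRing R] [IsDomain R]
    [IsPrincipalIdealRing R] [AddCommGroup M] [Module R M] [Module.Free R M]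
    (N : Submodule R M) : Module.Free R N := by
  obtain ⟨⟨I, b⟩⟩ := Module.Free.exists_basis (R := R) (M := M)
  obtain ⟨_, _⟩ := exists_wellFoundedLT I
  -- Well-order the basis. `L i` holds the members of `N` supported on indices up to `i`, and `g i`
  -- generates the ideal of their `i`-th coefficients. Members attaining the nonzero `g i` form a
  -- basis, by comparing leading terms.
  let L : I → Submodule R M := fun i => N ⊓ ⨅ k : Set.Ioi i, LinearMap.ker (b.coord k)
  have hL : ∀ i x, x ∈ L i ↔ x ∈ N ∧ ∀ k, i < k → b.repr x k = 0 := by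
    intro i x
    simp [L]
  let g : I → R := fun i => Submodule.IsPrincipal.generator ((L i).map (b.coord i))
  have hg : ∀ i, ∃ n ∈ L i, b.repr n i = g i := fun i =>
    Submodule.IsPrincipal.generator_mem ((L i).map (b.coord i))
  choose n hnL hng using hg
  let v : {i // g i ≠ 0} → M := fun s => n s
  have hli : LinearIndependent R v := by
    rw [linearIndependent_iff]
    intro l hl
    by_contra hne
    have hsupp : l.support.Nonempty := Finsupp.support_nonempty_iff.2 hne
    let i := l.support.max' hsupp
    have hi : l i ≠ 0 := Finsupp.mem_support_iff.1 (l.support.max'_mem hsupp)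
    have h0 := congrArg (fun x => b.repr x i) hl
    simp only [Finsupp.linearCombination_apply, Finsupp.sum, map_sum, map_smul, map_zero,
      Finsupp.coe_zero, Pi.zero_apply, Finsupp.coe_finsetSum, Finset.sum_apply,
      Finsupp.coe_smul, Pi.smul_apply] at h0
    rw [Finset.sum_eq_single i] at h0
    · rw [show b.repr (v i) i = g i from hng i, smul_eq_mul] at h0
      exact mul_ne_zero hi i.2 h0
    · intro s hs hsi
      have hlt : (s : I) < i := lt_of_le_of_ne (l.support.le_max' s hs) fun h => hsi (Subtype.ext h)
      rw [show b.repr (v s) i = 0 from ((hL _ _).1 (hnL s)).2 i hlt, smul_zero]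
    · intro h
      exact absurd (l.support.max'_mem hsupp) h
  have hmax : ∀ x ∈ N, x ≠ 0 → ∃ i, b.repr x i ≠ 0 ∧ x ∈ L i := by
    intro x hx hx0
    have hsupp : (b.repr x).support.Nonempty := Finsupp.support_nonempty_iff.2 (by simpa using hx0)
    refine ⟨(b.repr x).support.max' hsupp,
      Finsupp.mem_support_iff.1 ((b.repr x).support.max'_mem hsupp), (hL _ _).2 ⟨hx, fun k hk => ?_⟩⟩
    by_contra hne
    exact absurd ((b.repr x).support.le_max' k (Finsupp.mem_support_iff.2 hne)) (not_le.2 hk)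
  have hspan : ∀ i, ∀ x ∈ L i, x ∈ Submodule.span R (Set.range v) := by
    intro i
    induction i using WellFoundedLT.induction with
    | ind i ih =>
      have h0 : ∀ x ∈ L i, b.repr x i = 0 → x ∈ Submodule.span R (Set.range v) := by
        intro x hx hxi
        by_cases hx0 : x = 0
        · rw [hx0]; exact zero_mem _
        obtain ⟨k, hk, hxk⟩ := hmax x ((hL _ _).1 hx).1 hx0
        refine ih k ?_ x hxk
        rcases lt_trichotomy k i with h | h | h
        · exact h
        · exact absurd hxi (h ▸ hk)
        · exact absurd (((hL _ _).1 hx).2 k h) hk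
      intro x hx
      obtain ⟨r, hr⟩ := (Submodule.IsPrincipal.mem_iff_eq_smul_generator _).1
        (Submodule.mem_map_of_mem (f := b.coord i) hx)
      by_cases hgi : g i = 0
      · refine h0 x hx ?_
        change b.repr x i = r • g i at hr
        rw [hr, hgi, smul_zero]
      · have h1 : x - r • n i ∈ Submodule.span R (Set.range v) := by
          refine h0 _ (sub_mem hx (Submodule.smul_mem _ _ (hnL i))) ?_
          change b.repr x i = r • g i at hr
          simp [hr, hng]
        have h2 : r • n i ∈ Submodule.span R (Set.range v) :=
          Submodule.smul_mem _ _ (Submodule.subset_span ⟨⟨i, hgi⟩, rfl⟩)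
        simpa using add_mem h1 h2
  have hN : N = Submodule.span R (Set.range v) := by
    refine le_antisymm (fun x hx => ?_) (Submodule.span_le.2 ?_)
    · by_cases hx0 : x = 0
      · rw [hx0]; exact zero_mem _
      obtain ⟨i, -, hi⟩ := hmax x hx hx0
      exact hspan i x hi
    · rintro _ ⟨s, rfl⟩
      exact ((hL _ _).1 (hnL s)).1
  rw [hN]
  exact Module.Free.of_basis (Module.Basis.span hli)

theorem Module.Free.of_injective_addMonoidHom {H M : Type*} [AddCommGroup H] [AddCommGroup M]
    [Module.Free ℤ M] (f : H →+ M) (hf : Function.Injective f) : Module.Free ℤ H := by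
  have := (LinearMap.range f.toIntLinearMap).free_of_free_of_isPrincipalIdealRing
  exact Module.Free.of_equiv (LinearEquiv.ofInjective f.toIntLinearMap hf).symm

end FreeSubmodule

/-! ### Combinatorics of branches: distinguished cuts -/

section Cuts

variable {k : ℕ} {κ : Fin k → Cardinal.{u}}

theorem BranchTuple.cut_eq_cut_iff {η ν : BranchTuple κ} {m : Fin k} {n : ℕ} :
    η.cut m n = ν.cut m n ↔ (∀ l ≠ m, η l = ν l) ∧ ∀ j < n, (η m).1 j = (ν m).1 j := by
  constructor
  · intro h
    simp only [BranchTuple.cut, NodeTuple.mk.injEq, heq_eq_eq, true_and] at h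
    refine ⟨fun l hl => congrFun h.2 ⟨l, hl⟩, fun j hj => ?_⟩
    exact congrFun (congrArg Subtype.val h.1) ⟨j, hj⟩
  · rintro ⟨h1, h2⟩
    simp only [BranchTuple.cut, NodeTuple.mk.injEq, heq_eq_eq, true_and]
    exact ⟨Subtype.ext (funext fun j => h2 j j.2), funext fun l => h1 l l.2⟩

theorem BranchTuple.exists_forall_cut_ne {η ν : BranchTuple κ} (h : η ≠ ν) (m : Fin k) :
    ∃ N, ∀ n ≥ N, η.cut m n ≠ ν.cut m n := by
  by_contra! hcon
  refine h (funext fun l => ?_)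
  by_cases hl : l = m
  · subst hl
    refine Subtype.ext (funext fun j => ?_)
    obtain ⟨n, hn, hcut⟩ := hcon (j + 1)
    exact (BranchTuple.cut_eq_cut_iff.1 hcut).2 j hn
  · obtain ⟨n, -, hcut⟩ := hcon 0
    exact (BranchTuple.cut_eq_cut_iff.1 hcut).1 l hl

theorem BranchTuple.exists_forall_mem_cut_ne {S : Set (BranchTuple κ)} (hS : S.Finite)
    (η : BranchTuple κ) (m : Fin k) :
    ∃ N, ∀ ν ∈ S, ν ≠ η → ∀ n ≥ N, η.cut m n ≠ ν.cut m n := by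
  have : ∀ ν, ∃ N, ν ≠ η → ∀ n ≥ N, η.cut m n ≠ ν.cut m n := by
    intro ν
    by_cases h : ν = η
    · exact ⟨0, fun h' => absurd h h'⟩
    · obtain ⟨N, hN⟩ := BranchTuple.exists_forall_cut_ne (Ne.symm h) m
      exact ⟨N, fun _ => hN⟩
  choose N hN using this
  obtain ⟨M, hM⟩ := (hS.image N).bddAbove
  exact ⟨M, fun ν hν hne n hn => hN ν hne n ((hM ⟨ν, hν, rfl⟩).trans hn)⟩

/-- Each `η ∈ Ω` has a coordinate in `u η` along which almost all cuts of `η` differ from the cuts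
of the members of `Ω` of the same or lower rank. -/
def HasDistinguishedCuts (Ω : Set (BranchTuple κ)) (u : BranchTuple κ → Finset (Fin k)) : Prop :=
  ∃ (ρ : BranchTuple κ → Ordinal.{u}) (ℓ : BranchTuple κ → Fin k) (N : BranchTuple κ → ℕ),
    ∀ η ∈ Ω, ℓ η ∈ u η ∧ ∀ ν ∈ Ω, ν ≠ η → ρ ν ≤ ρ η →
      ∀ n ≥ N η, η.cut (ℓ η) n ≠ ν.cut (ℓ η) n

/-- Rank by an enumeration: only finitely many branches come earlier, and two distinct branches
share only finitely many cuts in any coordinate. -/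
theorem hasDistinguishedCuts_of_countable {Ω : Set (BranchTuple κ)} (hΩ : Ω.Countable)
    [NeZero k] (u : BranchTuple κ → Finset (Fin k)) (hu : ∀ η ∈ Ω, (u η).Nonempty) :
    HasDistinguishedCuts Ω u := by
  obtain ⟨f, hf⟩ := Set.countable_iff_exists_injOn.1 hΩ
  choose! ℓ hℓ using hu
  have hfin : ∀ η, {ν ∈ Ω | f ν ≤ f η}.Finite := fun η =>
    Set.Finite.of_finite_image ((Set.finite_Iic (f η)).subset (by rintro _ ⟨ν, hν, rfl⟩; exact hν.2))
      (hf.mono fun ν hν => hν.1)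
  choose N hN using fun η => BranchTuple.exists_forall_mem_cut_ne (hfin η) η (ℓ η)
  exact ⟨fun η => f η, ℓ, N, fun η hη => ⟨hℓ η hη, fun ν hν hne hle n hn =>
    hN η ν ⟨hν, Nat.cast_le.1 hle⟩ hne n hn⟩⟩

/-- Code the entries of `Ω` in `ω_{f+1}` and sort branches into layers by their largest code,
attained at coordinate `top η`. A layer has size at most `ℵ_f`, so induction applies to it with `top
η` removed from `u η`. A cut at another coordinate retains the entry at `top η`, so no branch of an
earlier layer shares it. -/
theorem hasDistinguishedCuts_of_mk_le [NeZero k] (f : ℕ) {Ω : Set (BranchTuple κ)} (hΩ : #Ω ≤ ℵ_ f)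
    (u : BranchTuple κ → Finset (Fin k)) (hu : ∀ η ∈ Ω, f < (u η).card) :
    HasDistinguishedCuts Ω u := by
  classical
  induction f generalizing Ω u with
  | zero =>
    refine hasDistinguishedCuts_of_countable ?_ u fun η hη => Finset.card_pos.1 (hu η hη)
    rw [← Set.countable_coe_iff, ← mk_le_aleph0_iff]
    simpa using hΩ
  | succ f ih =>
    let W := (ℵ_ ((f + 1 : ℕ) : Ordinal.{u})).ord.ToType
    have hW : #W = ℵ_ ((f + 1 : ℕ) : Ordinal.{u}) := mk_ord_toType _
    have hne : Nonempty W := mk_ne_zero_iff.1 (by rw [hW]; exact (aleph_pos _).ne')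
    have hIic : ∀ δ : W, #(Set.Iic δ) ≤ ℵ_ (f : Ordinal.{u}) := fun δ => by
      have h1 : #(Set.Iic δ) < #W := mk_Iic_lt δ (by simp [W]) (by simp [W])
      have h2 : ℵ_ ((f + 1 : ℕ) : Ordinal.{u}) = Order.succ (ℵ_ (f : Ordinal.{u})) := by
        rw [Nat.cast_succ, succ_aleph]
      exact Order.lt_succ_iff.1 (h1.trans_eq (hW.trans h2))
    have hτ : ∀ m, ∃ τ : IncSeq (κ m) → W, Set.InjOn τ ((fun η : BranchTuple κ => η m) '' Ω) := by
      intro m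
      obtain ⟨e⟩ : Nonempty (((fun η : BranchTuple κ => η m) '' Ω) ↪ W) := by
        rw [← le_def, hW]
        exact mk_image_le.trans hΩ
      refine ⟨fun x => if h : x ∈ (fun η : BranchTuple κ => η m) '' Ω then e ⟨x, h⟩ else hne.some,
        fun x hx y hy hxy => ?_⟩
      simp only [hx, hy, dif_pos] at hxy
      exact congrArg Subtype.val (e.injective hxy)
    choose τ hτ using hτ
    have hτ' : ∀ η ∈ Ω, ∀ ν ∈ Ω, ∀ m, τ m (η m) = τ m (ν m) → η m = ν m :=
      fun η hη ν hν m h => hτ m ⟨η, hη, rfl⟩ ⟨ν, hν, rfl⟩ h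
    choose top htop using fun η : BranchTuple κ => Finite.exists_max fun m => τ m (η m)
    let ρ₀ : BranchTuple κ → W := fun η => τ (top η) (η (top η))
    have hlayer : ∀ δ, #{η ∈ Ω | ρ₀ η = δ} ≤ ℵ_ (f : Ordinal.{u}) := by
      intro δ
      let φ : {η ∈ Ω | ρ₀ η = δ} → Fin k → Set.Iic δ := fun η m =>
        ⟨τ m (η.1 m), (htop η.1 m).trans_eq η.2.2⟩
      have hφ : Function.Injective φ := fun η ν h => Subtype.ext (funext fun m =>
        hτ' _ η.2.1 _ ν.2.1 m (congrArg Subtype.val (congrFun h m)))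
      refine (mk_le_of_injective hφ).trans ?_
      rw [mk_arrow, mk_fin, lift_natCast, lift_uzero]
      rw [power_natCast]
      exact (pow_le_pow_left' (hIic δ) k).trans (power_nat_le (aleph0_le_aleph _))
    choose ρ ℓ N h using fun δ => ih (hlayer δ) (fun η => (u η).erase (top η)) fun η hη => by
      have := hu η hη.1
      have := Finset.pred_card_le_card_erase (s := u η) (a := top η)
      omega
    -- Layers come first, then the rank within the layer; the well-founded rank turns this pair into
    -- one ordinal.
    let key : BranchTuple κ → W ×ₗ Ordinal.{u} := fun η => toLex (ρ₀ η, ρ (ρ₀ η) η)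
    have : IsWellFounded (BranchTuple κ) (InvImage (· < ·) key) := ⟨InvImage.wf _ wellFounded_lt⟩
    refine ⟨IsWellFounded.rank (InvImage (· < ·) key), fun η => ℓ (ρ₀ η) η, fun η => N (ρ₀ η) η,
      fun η hη => ?_⟩
    obtain ⟨h1, h2⟩ := h (ρ₀ η) η ⟨hη, rfl⟩
    rw [Finset.mem_erase] at h1
    refine ⟨h1.2, fun ν hν hne hle n hn hcut => ?_⟩
    have hkey : key ν ≤ key η := by
      by_contra hlt
      exact absurd (IsWellFounded.rank_lt_of_rel (r := InvImage (· < ·) key) (not_le.1 hlt))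
        (not_lt.2 hle)
    rcases Prod.Lex.toLex_le_toLex.1 hkey with hlt | ⟨heq, hle'⟩
    · have h3 := (BranchTuple.cut_eq_cut_iff.1 hcut).1 (top η) (Ne.symm h1.1)
      have h4 : ρ₀ η ≤ ρ₀ ν := by
        change τ (top η) (η (top η)) ≤ _
        rw [h3]
        exact htop ν _
      exact absurd hlt (not_lt.2 h4)
    · simp only at heq hle'
      rw [heq] at hle'
      exact h2 ν ⟨hν, heq⟩ hne hle' n hn hcut

end Cuts

/-! ### The branch group and its freeness -/

section BranchGroup

variable {k : ℕ} {κ : Fin k → Cardinal.{u}}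

open Classical in
/-- The basis vector `e_ν`. -/
noncomputable def nodeVector (ν : NodeTuple κ) : NodeTuple κ → ℤ := Pi.single ν 1

theorem nodeVector_self (ν : NodeTuple κ) : nodeVector ν ν = 1 := by
  classical exact Pi.single_eq_same ν _

theorem nodeVector_of_ne {ν μ : NodeTuple κ} (h : μ ≠ ν) : nodeVector ν μ = 0 := by
  classical exact Pi.single_eq_of_ne h _

theorem branchElement_apply_of_lt (η : BranchTuple κ) {i : ℕ} {ν : NodeTuple κ} (h : ν.n < i) :
    branchElement η i ν = 0 := if_neg fun h' => absurd h'.1 (not_le.2 h)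

theorem branchElement_apply_of_ne {η : BranchTuple κ} (i : ℕ) {ν : NodeTuple κ}
    (h : ν ≠ η.cut ν.m ν.n) : branchElement η i ν = 0 := if_neg fun h' => h h'.2

theorem branchElement_apply_cut (η : BranchTuple κ) {i n : ℕ} (h : i ≤ n) (m : Fin k) :
    branchElement η i (η.cut m n) = ((n.factorial / i.factorial : ℕ) : ℤ) := if_pos ⟨h, rfl⟩

theorem branchElement_succ (η : BranchTuple κ) (i : ℕ) :
    branchElement η i =
      ∑ m, nodeVector (η.cut m i) + (i + 1) • branchElement η (i + 1) := by
  funext ν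
  simp only [Pi.add_apply, Finset.sum_apply, Pi.smul_apply]
  by_cases hν : ν = η.cut ν.m ν.n
  · rcases lt_trichotomy ν.n i with h | h | h
    · rw [branchElement_apply_of_lt η h, branchElement_apply_of_lt η (h.trans (Nat.lt_succ_self i)),
        Finset.sum_eq_zero, smul_zero, add_zero]
      intro m _
      exact nodeVector_of_ne fun h' => h.ne (congrArg NodeTuple.n h')
    · rw [branchElement_apply_of_lt η (h.trans_lt (Nat.lt_succ_self i)), smul_zero, add_zero,
        Finset.sum_eq_single ν.m, ← h, ← hν, nodeVector_self]
      · rw [hν]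
        refine (branchElement_apply_cut η le_rfl ν.m).trans ?_
        rw [Nat.div_self (Nat.factorial_pos _), Nat.cast_one]
      · intro m _ hm
        exact nodeVector_of_ne fun h' => hm (congrArg NodeTuple.m h').symm
      · simp
    · rw [Finset.sum_eq_zero, zero_add, hν, branchElement_apply_cut η h.le,
        branchElement_apply_cut η h]
      · rw [nsmul_eq_mul, ← Nat.cast_mul]
        congr 1
        rw [Nat.factorial_succ, ← Nat.mul_div_assoc _ (Nat.factorial_succ i ▸
          Nat.factorial_dvd_factorial h), Nat.mul_div_mul_left _ _ (Nat.succ_pos i)]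
      · intro m _
        exact nodeVector_of_ne fun h' => h.ne' (congrArg NodeTuple.n h')
  · rw [branchElement_apply_of_ne i hν, branchElement_apply_of_ne (i + 1) hν, Finset.sum_eq_zero,
      smul_zero, add_zero]
    intro m _
    refine nodeVector_of_ne fun h' => hν ?_
    rw [h']
    rfl

/-- The span of all basis vectors and of the branch elements that come from `Ω`. -/
def partialBranchModule (Ω : Set (BranchTuple κ)) : Submodule ℤ (NodeTuple κ → ℤ) :=
  Submodule.span ℤ (Set.range nodeVector ∪ {x | ∃ η ∈ Ω, ∃ i, branchElement η i = x})

theorem partialBranchModule_mono {Ω Ω' : Set (BranchTuple κ)} (h : Ω ⊆ Ω') :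
    partialBranchModule Ω ≤ partialBranchModule Ω' :=
  Submodule.span_mono (Set.union_subset_union_right _
    (by rintro x ⟨η, hη, hx⟩; exact ⟨η, h hη, hx⟩))

/-- A basis arises by exchanging each distinguished `e_{η ↾ ⟨ℓ η, n⟩}`, `n ≥ N η`, for `y_{η,n}`, in
which it has coefficient 1. -/
theorem HasDistinguishedCuts.free_partialBranchModule {Ω : Set (BranchTuple κ)}
    {u : BranchTuple κ → Finset (Fin k)} (h : HasDistinguishedCuts Ω u) :
    Module.Free ℤ (partialBranchModule Ω) := by
  classical
  obtain ⟨ρ, ℓ, N, h⟩ := h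
  let I := {ν : NodeTuple κ // ∀ η ∈ Ω, ∀ n ≥ N η, ν ≠ η.cut (ℓ η) n}
  let J := {p : BranchTuple κ × ℕ // p.1 ∈ Ω ∧ N p.1 ≤ p.2}
  let v : I ⊕ J → NodeTuple κ → ℤ :=
    Sum.elim (fun ν => nodeVector ν.1) fun p => branchElement p.1.1 p.1.2
  have hli : LinearIndependent ℤ v := by
    rw [linearIndependent_iff]
    intro l hl
    have key : ∀ s₀ ∈ l.support, ∀ ν, v s₀ ν = 1 →
        (∀ s ∈ l.support, s ≠ s₀ → v s ν = 0) → False := by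
      intro s₀ hs₀ ν h1 h0
      have hsum := congrFun hl ν
      rw [Finsupp.linearCombination_apply, Finsupp.sum, Finset.sum_apply,
        Finset.sum_eq_single_of_mem s₀ hs₀ fun s hs hne => by
          rw [Pi.smul_apply, h0 s hs hne, smul_zero], Pi.smul_apply, h1] at hsum
      simp only [smul_eq_mul, mul_one, Pi.zero_apply] at hsum
      exact Finsupp.mem_support_iff.1 hs₀ hsum
    have hinr : ∀ p, Sum.inr p ∉ l.support := by
      intro p hp
      let S := l.support.preimage Sum.inr Sum.inr_injective.injOn
      -- Take a branch of maximal rank in the relation, then its least index: the distinguished cut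
      -- there occurs in no other term.
      obtain ⟨p₁, hp₁, hmax⟩ := S.exists_max_image (fun p => ρ p.1.1)
        ⟨p, Finset.mem_preimage.2 hp⟩
      obtain ⟨p₀, hp₀, hmin⟩ := (S.filter fun p => p.1.1 = p₁.1.1).exists_min_image
        (fun p => p.1.2) ⟨p₁, Finset.mem_filter.2 ⟨hp₁, rfl⟩⟩
      obtain ⟨hp₀S, hp₀₁⟩ := Finset.mem_filter.1 hp₀
      refine key (Sum.inr p₀) (Finset.mem_preimage.1 hp₀S) (p₀.1.1.cut (ℓ p₀.1.1) p₀.1.2) ?_ ?_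
      · change branchElement _ _ _ = 1
        rw [branchElement_apply_cut _ le_rfl, Nat.div_self (Nat.factorial_pos _), Nat.cast_one]
      · rintro (ν | q) hs hne
        · exact nodeVector_of_ne (ν.2 p₀.1.1 p₀.2.1 p₀.1.2 p₀.2.2).symm
        · have hqS : q ∈ S := Finset.mem_preimage.2 hs
          by_cases hq : q.1.1 = p₀.1.1
          · have hle := hmin q (Finset.mem_filter.2 ⟨hqS, hq.trans hp₀₁⟩)
            refine branchElement_apply_of_lt _ (lt_of_le_of_ne hle fun heq => hne ?_)
            exact congrArg Sum.inr (Subtype.ext (Prod.ext hq heq.symm))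
          · refine branchElement_apply_of_ne _ ?_
            exact (h p₀.1.1 p₀.2.1).2 q.1.1 q.2.1 hq (hp₀₁ ▸ hmax q hqS) _ p₀.2.2
    ext s
    by_contra hs
    have hs' : s ∈ l.support := Finsupp.mem_support_iff.2 hs
    rcases s with ν | p
    · refine key _ hs' ν.1 (nodeVector_self ν.1) ?_
      rintro (μ | q) hq hne
      · exact nodeVector_of_ne fun heq => hne (congrArg Sum.inl (Subtype.ext heq.symm))
      · exact absurd hq (hinr q)
    · exact hinr p hs'
  have hspan : partialBranchModule Ω = Submodule.span ℤ (Set.range v) := by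
    have hy : ∀ η ∈ Ω, ∀ n ≥ N η, branchElement η n ∈ Submodule.span ℤ (Set.range v) :=
      fun η hη n hn => Submodule.subset_span ⟨Sum.inr ⟨(η, n), hη, hn⟩, rfl⟩
    have hcut : ∀ o : Ordinal.{u}, ∀ η ∈ Ω, ρ η = o → ∀ n ≥ N η,
        nodeVector (η.cut (ℓ η) n) ∈ Submodule.span ℤ (Set.range v) := by
      intro o
      induction o using WellFoundedLT.induction with
      | ind o ih =>
        intro η hη ho n hn
        have hrec := branchElement_succ η n
        rw [← Finset.add_sum_erase _ _ (Finset.mem_univ (ℓ η)), add_assoc] at hrec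
        rw [← sub_eq_iff_eq_add] at hrec
        rw [← hrec]
        refine sub_mem (hy η hη n hn) (add_mem (sum_mem fun m hm => ?_)
          (nsmul_mem (hy η hη (n + 1) (hn.trans n.le_succ)) _))
        by_cases hI : ∀ ν ∈ Ω, ∀ j ≥ N ν, η.cut m n ≠ ν.cut (ℓ ν) j
        · exact Submodule.subset_span ⟨Sum.inl ⟨_, hI⟩, rfl⟩
        · push Not at hI
          obtain ⟨ν, hν, j, hj, heq⟩ := hI
          rw [heq]
          obtain rfl : m = ℓ ν := congrArg NodeTuple.m heq
          obtain rfl : n = j := congrArg NodeTuple.n heq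
          refine ih (ρ ν) ?_ ν hν rfl n hj
          rw [← ho]
          by_contra hle
          -- If `ν` had rank at least that of `η`, its distinguished cut could not be a cut of `η`.
          exact (h ν hν).2 η hη (fun h' => (Finset.mem_erase.1 hm).1 (by rw [h']))
            (not_lt.1 hle) n hj heq.symm
    have hnode : ∀ ν, nodeVector ν ∈ Submodule.span ℤ (Set.range v) := by
      intro ν
      by_cases hI : ∀ η ∈ Ω, ∀ j ≥ N η, ν ≠ η.cut (ℓ η) j
      · exact Submodule.subset_span ⟨Sum.inl ⟨_, hI⟩, rfl⟩
      · push Not at hI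
        obtain ⟨η, hη, j, hj, rfl⟩ := hI
        exact hcut _ η hη rfl j hj
    have hbranch : ∀ η ∈ Ω, ∀ d i, N η ≤ i + d →
        branchElement η i ∈ Submodule.span ℤ (Set.range v) := by
      intro η hη d
      induction d with
      | zero => exact fun i hi => hy η hη i hi
      | succ d ih =>
        intro i hi
        rw [branchElement_succ]
        exact add_mem (sum_mem fun m _ => hnode _) (nsmul_mem (ih (i + 1) (by omega)) _)
    refine le_antisymm (Submodule.span_le.2 ?_) (Submodule.span_le.2 ?_)
    · rintro x (⟨ν, rfl⟩ | ⟨η, hη, i, rfl⟩)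
      · exact hnode ν
      · exact hbranch η hη (N η) i (Nat.le_add_left _ _)
    · rintro _ ⟨ν | p, rfl⟩
      · exact Submodule.subset_span (Or.inl ⟨ν.1, rfl⟩)
      · exact Submodule.subset_span (Or.inr ⟨p.1.1, p.2.1, p.1.2, rfl⟩)
  rw [hspan]
  exact Module.Free.of_basis (Module.Basis.span hli)

theorem nodeVector_mem_branchGroup (ν : NodeTuple κ) : nodeVector ν ∈ branchGroup κ :=
  AddSubgroup.subset_closure (Or.inl ⟨ν, rfl⟩)

theorem branchElement_mem_branchGroup (η : BranchTuple κ) (i : ℕ) :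
    branchElement η i ∈ branchGroup κ :=
  AddSubgroup.subset_closure (Or.inr ⟨(η, i), rfl⟩)

theorem exists_finite_mem_partialBranchModule {x : NodeTuple κ → ℤ} (hx : x ∈ branchGroup κ) :
    ∃ S : Set (BranchTuple κ), S.Finite ∧ x ∈ partialBranchModule S := by
  induction hx using AddSubgroup.closure_induction with
  | mem x hx =>
    rcases hx with ⟨ν, rfl⟩ | ⟨⟨η, i⟩, rfl⟩
    · exact ⟨∅, Set.finite_empty, Submodule.subset_span (Or.inl ⟨ν, rfl⟩)⟩
    · exact ⟨{η}, Set.finite_singleton η, Submodule.subset_span (Or.inr ⟨η, rfl, i, rfl⟩)⟩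
  | zero => exact ⟨∅, Set.finite_empty, zero_mem _⟩
  | add x y _ _ hx hy =>
    obtain ⟨S, hS, hxS⟩ := hx
    obtain ⟨T, hT, hyT⟩ := hy
    exact ⟨S ∪ T, hS.union hT, add_mem (partialBranchModule_mono Set.subset_union_left hxS)
      (partialBranchModule_mono Set.subset_union_right hyT)⟩
  | neg x _ hx =>
    obtain ⟨S, hS, hxS⟩ := hx
    exact ⟨S, hS, neg_mem hxS⟩

/-- Each element involves finitely many branches, so a subgroup of size at most `ℵ_f` needs at most
`ℵ_f` of them, while `f + 1` coordinates are available. -/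
theorem isCardFree_branchGroup (f : ℕ) (κ : Fin (f + 1) → Cardinal.{u}) :
    IsCardFree (ℵ_ ((f + 1 : ℕ) : Ordinal.{u})) (branchGroup κ) := by
  intro H hH
  rw [Nat.cast_succ, ← succ_aleph, Order.lt_succ_iff] at hH
  choose S hSfin hS using fun x : H => exists_finite_mem_partialBranchModule x.1.2
  have hΩ : #(⋃ x, S x) ≤ ℵ_ (f : Ordinal.{u}) := by
    refine (mk_iUnion_le _).trans ((mul_le_mul' hH (ciSup_le' fun x =>
      ((hSfin x).lt_aleph0.le).trans (aleph0_le_aleph _))).trans_eq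
      (mul_eq_self (aleph0_le_aleph _)))
  have := (hasDistinguishedCuts_of_mk_le f hΩ (fun _ => Finset.univ)
    fun _ _ => by simp).free_partialBranchModule
  let φ : H →+ partialBranchModule (⋃ x, S x) :=
    { toFun := fun x => ⟨x.1.1, partialBranchModule_mono (Set.subset_iUnion S x) (hS x)⟩
      map_zero' := rfl
      map_add' := fun _ _ => rfl }
  exact Module.Free.of_injective_addMonoidHom φ fun x y h => by
    have h' : (φ x).1 = (φ y).1 := congrArg Subtype.val h
    exact Subtype.ext (Subtype.ext h')

end BranchGroup

/-- A small subgroup lies in the direct sum of its projections, which are small and hence free. -/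
theorem IsCardFree.directSum {κ : Cardinal.{u}} {ι G : Type u} [AddCommGroup G]
    (hG : IsCardFree κ G) : IsCardFree κ (DirectSum ι fun _ => G) := by
  classical
  intro H hH
  let P : ι → AddSubgroup G := fun i => H.map (DFinsupp.evalAddMonoidHom i)
  have hP : ∀ i, Module.Free ℤ (P i) := fun i => hG _ (mk_image_le.trans_lt hH)
  let φ : (DirectSum ι fun i => P i) →+ DirectSum ι fun _ => G :=
    DirectSum.map fun i => (P i).subtype
  have hφ : Function.Injective φ := (DirectSum.map_injective _).2 fun i => Subtype.val_injective
  have hle : H ≤ φ.range := by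
    intro x hx
    refine ⟨DFinsupp.mk x.support fun i => ⟨x i, ⟨x, hx, rfl⟩⟩, DFinsupp.ext fun i => ?_⟩
    refine (DirectSum.map_apply _ _ _).trans ?_
    erw [DFinsupp.mk_apply]
    split_ifs with h
    · rfl
    · exact (DFinsupp.notMem_support_iff.1 h).symm
  have : Module.Free ℤ φ.range :=
    Module.Free.of_equiv (AddMonoidHom.ofInjective hφ).toIntLinearEquiv
  exact Module.Free.of_injective_addMonoidHom (AddSubgroup.inclusion hle)
    (AddSubgroup.inclusion_injective hle)

/-! ### Predicting functions on nodes along a branch -/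

section Prediction

/-- Code `T × c` in `c`: each fibre of the first projection has size `c`, whereas proper initial
segments are smaller. -/
theorem exists_forall_exists_gt_eq {c : Cardinal.{u}} (hc : ℵ₀ ≤ c) {T : Type u} [Nonempty T]
    (hT : #T ≤ c) : ∃ π : c.ord.ToType → T, ∀ t a, ∃ b, a < b ∧ π b = t := by
  let W := c.ord.ToType
  have hW : #W = c := mk_ord_toType c
  have hne : Nonempty W := mk_ne_zero_iff.1 (by rw [hW]; exact (aleph0_pos.trans_le hc).ne')
  obtain ⟨e⟩ : Nonempty (T × W ↪ W) := by
    rw [← le_def, mk_prod, lift_id, lift_id, hW]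
    exact (mul_le_mul_left hT c).trans_eq (mul_eq_self hc)
  have hs : Function.Surjective (Function.invFun e) := Function.invFun_surjective e.injective
  refine ⟨fun b => (Function.invFun e b).1, fun t a => ?_⟩
  by_contra! hcon
  have h1 : #W ≤ #(Set.Iic a) := by
    refine mk_le_of_injective (f := fun w => ⟨e (t, w), ?_⟩) fun w w' h => ?_
    · by_contra hlt
      exact hcon _ (not_le.1 hlt) (by rw [Function.leftInverse_invFun e.injective])
    · exact congrArg Prod.snd (e.injective (congrArg Subtype.val h))
  exact absurd (mk_Iic_lt a (by simp [W]) (by rw [hW]; exact hc)) (not_lt.2 h1)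

/-- The sequence in which each term is computed from the sequence of all earlier terms. -/
noncomputable def seqOfFin {W : Type*} (G : ∀ n : ℕ, (Fin n → W) → W) : ℕ → W
  | n => G n fun j => seqOfFin G j
termination_by n => n
decreasing_by exact j.2

theorem seqOfFin_eq {W : Type*} (G : ∀ n : ℕ, (Fin n → W) → W) (n : ℕ) :
    seqOfFin G n = G n fun j => seqOfFin G j := by
  rw [seqOfFin]

theorem exists_incSeq_forall_eq {c : Cardinal.{u}} (hc : c ≠ 0) {T : Type*}
    {π : c.ord.ToType → T} (hπ : ∀ t a, ∃ b, a < b ∧ π b = t) (F : ∀ n, FinIncSeq c n → T) :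
    ∃ ξ : IncSeq c, ∀ n, π (ξ.1 n) = F n (ξ.restrict n) := by
  classical
  have hne : Nonempty c.ord.ToType := mk_ne_zero_iff.1 (by rwa [mk_ord_toType])
  have hG : ∀ n (s : Fin n → c.ord.ToType), ∃ b, (∀ j, s j < b) ∧
      ∀ hs : StrictMono s, π b = F n ⟨s, hs⟩ := by
    intro n s
    obtain ⟨a, ha⟩ := (Set.finite_range s).bddAbove
    by_cases hs : StrictMono s
    · obtain ⟨b, hab, hb⟩ := hπ (F n ⟨s, hs⟩) a
      exact ⟨b, fun j => (ha ⟨j, rfl⟩).trans_lt hab, fun _ => hb⟩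
    -- Default for non-increasing inputs; it still exceeds all of them, so that monotonicity can be
    -- proved first.
    · obtain ⟨b, hab, -⟩ := hπ (π a) a
      exact ⟨b, fun j => (ha ⟨j, rfl⟩).trans_lt hab, fun h => absurd h hs⟩
  choose G hG1 hG2 using hG
  have hmono : StrictMono (seqOfFin G) := fun i n hin => by
    rw [seqOfFin_eq G n]
    exact hG1 n (fun j => seqOfFin G j) ⟨i, hin⟩
  refine ⟨⟨seqOfFin G, hmono⟩, fun n => ?_⟩
  change π (seqOfFin G n) = _
  rw [seqOfFin_eq G n]
  exact hG2 n _ fun _ _ h => hmono h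

theorem nonempty_incSeq {c : Cardinal.{u}} (hc : ℵ₀ ≤ c) : Nonempty (IncSeq c) := by
  obtain ⟨π, hπ⟩ := exists_forall_exists_gt_eq (T := PUnit.{u + 1}) hc
    (by simpa using one_le_aleph0.trans hc)
  obtain ⟨ξ, -⟩ := exists_incSeq_forall_eq (aleph0_pos.trans_le hc).ne' hπ fun _ _ => ⟨⟩
  exact ⟨ξ⟩

variable {k : ℕ} {κ : Fin k → Cardinal.{u}}

/-- A family of guesses along the branches that is correct, for every function on the set of nodes,
along at least one branch. -/
theorem exists_prediction (hinf : ∀ m, ℵ₀ ≤ κ m) {C : Type u} [Nonempty C]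
    (hC : ∀ m, #((∀ l : {l : Fin k // l < m}, IncSeq (κ l)) → C) ≤ κ m) :
    ∃ g : BranchTuple κ → Fin k → ℕ → C, ∀ h : NodeTuple κ → C, ∃ η : BranchTuple κ,
      ∀ m n, h (η.cut m n) = g η m n := by
  classical
  choose π hπ using fun m => exists_forall_exists_gt_eq (hinf m) (hC m)
  -- The ordinal `η_m(n)` codes a function of the coordinates below `m`; the guess is its value at
  -- the lower entries of `η`.
  refine ⟨fun η m n => π m ((η m).1 n) fun l => η l, fun h => ?_⟩
  have key : ∀ d m, k ≤ m + d → ∃ η : BranchTuple κ, ∀ x : BranchTuple κ,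
      (∀ l : Fin k, m ≤ l → x l = η l) → ∀ (m' : Fin k) n, m ≤ m' →
        h (x.cut m' n) = π m' ((x m').1 n) fun l => x l := by
    intro d
    induction d with
    | zero =>
      exact fun m hm => ⟨fun m => (nonempty_incSeq (hinf m)).some,
        fun x _ m' n hm' => absurd m'.2 (by omega)⟩
    | succ d ih =>
      intro m hm
      obtain ⟨η, hη⟩ := ih (m + 1) (by omega)
      by_cases hmk : k ≤ m
      · exact ⟨η, fun x _ m' n hm' => absurd m'.2 (by omega)⟩
      obtain ⟨p, rfl⟩ : ∃ p : Fin k, (p : ℕ) = m := ⟨⟨m, not_le.1 hmk⟩, rfl⟩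
      -- Coordinates are chosen from the top down. The node cut at `n` does not involve `ξ(n)`, so
      -- `ξ(n)` can code the values of `h` there for all lower coordinates at once.
      obtain ⟨ξ, hξ⟩ := exists_incSeq_forall_eq (aleph0_pos.trans_le (hinf p)).ne' (hπ p)
        fun n s x => h ⟨p, n, s, fun l => if hl : l.1 < p then x ⟨l, hl⟩ else η l⟩
      refine ⟨Function.update η p ξ, fun x hx m' n hm' => ?_⟩
      have hxgt : ∀ l : Fin k, p < l → x l = η l := fun l hl =>
        (hx l (le_of_lt hl)).trans (Function.update_of_ne hl.ne' ξ η)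
      rcases eq_or_lt_of_le hm' with heq | hlt
      · obtain rfl : p = m' := Fin.ext heq
        have hxp : x p = ξ := (hx p le_rfl).trans (Function.update_self p ξ η)
        rw [hxp, hξ]
        congr 1
        simp only [BranchTuple.cut, NodeTuple.mk.injEq, heq_eq_eq, true_and, hxp]
        funext l
        split_ifs with hl
        · rfl
        · exact hxgt l (lt_of_le_of_ne (not_lt.1 hl) l.2.symm)
      · exact hη x (fun l hl => hxgt l hl) m' n hlt
  obtain ⟨η, hη⟩ := key k 0 (by omega)
  exact ⟨η, fun m n => hη η (fun _ _ => rfl) m n (Nat.zero_le _)⟩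

end Prediction

/-! ### From vanishing Ext to solvable systems -/

section Ext

variable {k : ℕ} {κ : Fin k → Cardinal.{u}}

/-- The members of the group with only finitely many nonzero coordinates. -/
def finiteSupportSubgroup (κ : Fin k → Cardinal.{u}) : AddSubgroup (branchGroup κ) where
  carrier := {x | (Function.support x.1).Finite}
  zero_mem' := by simp
  add_mem' hx hy := (Set.Finite.union hx hy).subset (Function.support_add _ _)
  neg_mem' hx := by simpa using hx

theorem finite_support_nodeVector (ν : NodeTuple κ) : (Function.support (nodeVector ν)).Finite :=
  (Set.finite_singleton ν).subset fun μ hμ => by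
    by_contra h
    exact hμ (nodeVector_of_ne h)

/-- The branch element as a member of the group. -/
noncomputable def branchMember (η : BranchTuple κ) (i : ℕ) : branchGroup κ :=
  ⟨branchElement η i, branchElement_mem_branchGroup η i⟩

/-- The basis vector as a member of the finitely supported part of the group. -/
noncomputable def nodeMember (ν : NodeTuple κ) : finiteSupportSubgroup κ :=
  ⟨⟨nodeVector ν, nodeVector_mem_branchGroup ν⟩, finite_support_nodeVector ν⟩

theorem branchMember_sub (η : BranchTuple κ) (i : ℕ) :
    branchMember η i - (i + 1) • branchMember η (i + 1) =
      ((∑ m, nodeMember (η.cut m i) : finiteSupportSubgroup κ) : branchGroup κ) := by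
  apply Subtype.ext
  refine (sub_eq_iff_eq_add.2 (branchElement_succ η i)).trans ?_
  exact (map_sum ((branchGroup κ).subtype.comp (finiteSupportSubgroup κ).subtype)
    (fun m => nodeMember (η.cut m i)) Finset.univ).symm

/-- If `η` has nonzero coefficient in a combination, so do its cuts `η ↾ ⟨0, n⟩` for all large `n`,
and the support is infinite. -/
theorem linearIndependent_mk_branchMember [NeZero k] (N : ℕ) :
    LinearIndependent ℤ fun η : BranchTuple κ =>
      QuotientAddGroup.mk' (finiteSupportSubgroup κ) (branchMember η N) := by
  classical
  rw [linearIndependent_iff]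
  intro b hb
  have hfin : (Function.support
      (Finsupp.linearCombination ℤ (fun η : BranchTuple κ => branchElement η N) b)).Finite := by
    have h1 := Finsupp.apply_linearCombination ℤ
      (QuotientAddGroup.mk' (finiteSupportSubgroup κ)).toIntLinearMap
      (fun η : BranchTuple κ => branchMember η N) b
    have h2 := Finsupp.apply_linearCombination ℤ (branchGroup κ).subtype.toIntLinearMap
      (fun η : BranchTuple κ => branchMember η N) b
    have h3 : Finsupp.linearCombination ℤ (fun η : BranchTuple κ => branchMember η N) b ∈
        finiteSupportSubgroup κ := (QuotientAddGroup.eq_zero_iff _).1 (h1.trans hb)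
    exact (congrArg (fun x => (Function.support x).Finite) h2).mp h3
  ext η
  by_contra hη
  obtain ⟨M, hM⟩ := BranchTuple.exists_forall_mem_cut_ne b.support.finite_toSet η 0
  have hcoord : ∀ n ≥ max M N, η.cut 0 n ∈ Function.support
      (Finsupp.linearCombination ℤ (fun η : BranchTuple κ => branchElement η N) b) := by
    intro n hn
    have hnM := (le_max_left _ _).trans hn
    have hnN := (le_max_right _ _).trans hn
    rw [Function.mem_support, Finsupp.linearCombination_apply, Finsupp.sum, Finset.sum_apply,
      Finset.sum_eq_single_of_mem η (Finsupp.mem_support_iff.2 hη) fun ν hν hne => by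
        rw [Pi.smul_apply, branchElement_apply_of_ne N (hM ν hν hne n hnM), smul_zero],
      Pi.smul_apply, branchElement_apply_cut η hnN, smul_eq_mul]
    refine mul_ne_zero hη (Nat.cast_ne_zero.2 (Nat.div_pos ?_ (Nat.factorial_pos N)).ne')
    exact Nat.factorial_le hnN
  refine Set.infinite_of_injective_forall_mem (f := fun n => η.cut 0 (max M N + n)) ?_
    (fun n => hcoord _ (Nat.le_add_right _ _)) hfin
  intro n n' h
  exact Nat.add_left_cancel (congrArg NodeTuple.n h)

theorem FactorialSolvable.of_extVanishes_branchGroup [NeZero k] (hinf : ∀ m, ℵ₀ ≤ κ m)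
    {C : Type u} [AddCommGroup C]
    (hC : ∀ m, #((∀ l : {l : Fin k // l < m}, IncSeq (κ l)) → C) ≤ κ m)
    (h : ExtVanishes (branchGroup κ) C) : FactorialSolvable C := by
  intro d
  obtain ⟨g, hg⟩ := exists_prediction hinf hC
  have hmem : ∀ (η : BranchTuple κ) i, branchMember η i - (i + 1) • branchMember η (i + 1) ∈
      (QuotientAddGroup.mk' (finiteSupportSubgroup κ)).ker := fun η i => by
    rw [QuotientAddGroup.ker_mk', branchMember_sub]
    exact SetLike.coe_mem _
  obtain ⟨x, z, hz⟩ := h.exists_solution (QuotientAddGroup.mk' (finiteSupportSubgroup κ))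
    branchMember (fun η i => by
      have := hmem η i
      rwa [AddMonoidHom.mem_ker, map_sub, map_nsmul, sub_eq_zero] at this)
    -- With this right-hand side, a correct guess cancels the values of `x` and leaves `d i`.
    linearIndependent_mk_branchMember fun η i => d i - ∑ m, g η m i
  let incl : finiteSupportSubgroup κ →+ (QuotientAddGroup.mk' (finiteSupportSubgroup κ)).ker :=
    AddSubgroup.inclusion (QuotientAddGroup.ker_mk' _).ge
  obtain ⟨η, hη⟩ := hg fun ν => x (incl (nodeMember ν))
  refine ⟨z η, fun i => ?_⟩
  rw [hz η i (hmem η i), show (⟨_, hmem η i⟩ : (QuotientAddGroup.mk' _).ker) =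
    incl (∑ m, nodeMember (η.cut m i)) from Subtype.ext (branchMember_sub η i), map_sum, map_sum,
    Finset.sum_congr rfl fun m _ => hη m i, add_sub_cancel]

end Ext

/-! ### Cardinality of the branch group -/

section Cardinality

theorem mk_pi_le_of_finite {ι : Type} [Finite ι] {A : ι → Type u} {c : Cardinal.{u}} (hc : ℵ₀ ≤ c)
    (h : ∀ i, #(A i) ≤ c) : #(∀ i, A i) ≤ c := by
  have := Fintype.ofFinite ι
  have e : ∀ i, Nonempty (A i ↪ c.out) := fun i => by rw [← le_def, mk_out]; exact h i
  refine (mk_le_of_injective (f := fun (x : ∀ i, A i) i => (e i).some (x i)) fun x y hxy =>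
    funext fun i => (e i).some.injective (congrFun hxy i)).trans ?_
  rw [mk_arrow, mk_fintype ι, lift_natCast, lift_uzero, power_natCast, mk_out]
  exact power_nat_le hc

theorem mk_sigma_le_of_countable {ι : Type} [Countable ι] {A : ι → Type u} {c : Cardinal.{u}}
    (hc : ℵ₀ ≤ c) (h : ∀ i, #(A i) ≤ c) : #(Σ i, A i) ≤ c := by
  have e : ∀ i, Nonempty (A i ↪ c.out) := fun i => by rw [← le_def, mk_out]; exact h i
  refine (mk_le_of_injective (f := fun x : Σ i, A i => (x.1, (e x.1).some x.2)) ?_).trans ?_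
  · rintro ⟨i, x⟩ ⟨j, y⟩ hxy
    obtain rfl : i = j := congrArg Prod.fst hxy
    exact congrArg _ ((e i).some.injective (congrArg Prod.snd hxy))
  · rw [mk_prod, mk_out, lift_uzero]
    refine (mul_le_mul_left (b := lift.{u} #ι) (c := ℵ₀) ?_ c).trans_eq (aleph0_mul_eq hc)
    exact lift_le_aleph0.2 mk_le_aleph0

theorem mk_incSeq_le (c : Cardinal.{u}) : #(IncSeq c) ≤ c ^ ℵ₀ := by
  refine (mk_subtype_le _).trans_eq ?_
  rw [mk_arrow, mk_ord_toType, mk_nat, lift_aleph0, lift_uzero]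

variable {k : ℕ} {κ : Fin k → Cardinal.{u}} {c : Cardinal.{u}}

theorem mk_branchTuple_le (hc : ℵ₀ ≤ c) (h : ∀ m, κ m ^ ℵ₀ ≤ c) : #(BranchTuple κ) ≤ c :=
  mk_pi_le_of_finite hc fun m => (mk_incSeq_le _).trans (h m)

theorem mk_nodeTuple_le (hc : ℵ₀ ≤ c) (h : ∀ m, κ m ^ ℵ₀ ≤ c) : #(NodeTuple κ) ≤ c := by
  let A : Fin k × ℕ → Type u := fun p =>
    FinIncSeq (κ p.1) p.2 × ∀ l : {l : Fin k // l ≠ p.1}, IncSeq (κ l)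
  refine (mk_le_of_injective (f := fun ν : NodeTuple κ =>
    (⟨(ν.m, ν.n), ν.short, ν.rest⟩ : Σ p, A p)) ?_).trans (mk_sigma_le_of_countable hc fun p => ?_)
  · rintro ⟨m, n, s, r⟩ ⟨m', n', s', r'⟩ heq
    simp only [Sigma.mk.injEq, Prod.mk.injEq] at heq
    obtain ⟨⟨rfl, rfl⟩, heq⟩ := heq
    obtain ⟨rfl, rfl⟩ := Prod.mk.inj (eq_of_heq heq)
    rfl
  · rw [mk_prod, lift_id, lift_id]
    refine (mul_le_mul' ?_ ?_).trans_eq (mul_eq_self hc)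
    · refine (mk_subtype_le _).trans (mk_pi_le_of_finite hc fun _ => ?_)
      rw [mk_ord_toType]
      exact (self_le_power _ one_le_aleph0).trans (h p.1)
    · exact mk_pi_le_of_finite hc fun l => (mk_incSeq_le _).trans (h l)

theorem mk_branchGroup_le [Nonempty (NodeTuple κ)] (hc : ℵ₀ ≤ c) (h : ∀ m, κ m ^ ℵ₀ ≤ c) :
    #(branchGroup κ) ≤ c := by
  let v : NodeTuple κ ⊕ BranchTuple κ × ℕ → NodeTuple κ → ℤ :=
    Sum.elim nodeVector fun p => branchElement p.1 p.2
  have hv : (branchGroup κ : Set (NodeTuple κ → ℤ)) ⊆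
      Set.range (Finsupp.linearCombination ℤ v) := by
    have hle : branchGroup κ ≤ (LinearMap.range (Finsupp.linearCombination ℤ v)).toAddSubgroup := by
      refine (AddSubgroup.closure_le _).2 ?_
      rintro x (⟨ν, rfl⟩ | ⟨p, rfl⟩)
      · exact ⟨Finsupp.single (Sum.inl ν) 1, by simp [v, nodeVector]⟩
      · exact ⟨Finsupp.single (Sum.inr p) 1, by simp [v]⟩
    exact fun x hx => hle hx
  refine (mk_le_mk_of_subset hv).trans (mk_range_le.trans ?_)
  rw [mk_finsupp_lift_of_infinite', mk_int, lift_uzero, lift_aleph0, mk_sum, mk_prod, mk_nat,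
    lift_id, lift_id, lift_uzero, lift_aleph0]
  have h1 := mk_branchTuple_le hc h
  refine max_le (add_le_of_le hc (mk_nodeTuple_le hc h) ?_) hc
  exact (mul_le_mul_left h1 ℵ₀).trans_eq (mul_aleph0_eq hc)

theorem nodeVector_injective : Function.Injective (nodeVector : NodeTuple κ → NodeTuple κ → ℤ) := by
  intro ν μ h
  by_contra hne
  have h1 := congrFun h ν
  rw [nodeVector_self, nodeVector_of_ne hne] at h1
  exact one_ne_zero h1

theorem mk_nodeTuple_le_mk_branchGroup : #(NodeTuple κ) ≤ #(branchGroup κ) :=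
  mk_le_of_injective (f := fun ν => ⟨nodeVector ν, nodeVector_mem_branchGroup ν⟩) fun _ _ h =>
    nodeVector_injective (congrArg Subtype.val h)

theorem le_mk_nodeTuple (hinf : ∀ m, ℵ₀ ≤ κ m) (m : Fin k) : κ m ≤ #(NodeTuple κ) := by
  have hne := fun m => nonempty_incSeq (hinf m)
  rw [← mk_ord_toType (κ m)]
  refine mk_le_of_injective (f := fun a => ⟨m, 1, ⟨fun _ => a, Subsingleton.strictMono _⟩,
    fun l => (hne l).some⟩) fun a b h => ?_
  obtain ⟨-, -, h, -⟩ := NodeTuple.mk.inj h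
  exact congrFun (congrArg Subtype.val (eq_of_heq h)) 0

end Cardinality

/-! ### Representatives of the non-cotorsion groups -/

section NonCotorsion

/-- All groups in question are quotients of the free group of rank `μ`, which has at most `2 ^ μ`
subgroups; `ℤ` shows that the system is nonempty. -/
theorem exists_isNonCotorsionSystem {μ : Cardinal.{u}} (hμ : ℵ₀ ≤ μ) :
    ∃ (ι : Type u) (D : ι → Type u) (_ : ∀ i, AddCommGroup (D i)),
      IsNonCotorsionSystem μ D ∧ #ι ≤ 2 ^ μ ∧ Nonempty ι := by
  let X := μ.out →₀ ℤ
  have hne : Nonempty μ.out := mk_ne_zero_iff.1 (by rw [mk_out]; exact (aleph0_pos.trans_le hμ).ne')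
  have hX : #X = μ := by
    rw [mk_finsupp_lift_of_infinite', mk_out, mk_int, lift_uzero, lift_aleph0, max_eq_left hμ]
  let 𝒦 := {K : AddSubgroup X // ¬ IsCotorsion (X ⧸ K)}
  let s : Setoid 𝒦 :=
    { r := fun K L => Nonempty ((X ⧸ K.1) ≃+ (X ⧸ L.1))
      iseqv := ⟨fun _ => ⟨AddEquiv.refl _⟩, fun ⟨e⟩ => ⟨e.symm⟩, fun ⟨e⟩ ⟨e'⟩ => ⟨e.trans e'⟩⟩ }
  have hsys : IsNonCotorsionSystem μ fun i : Quotient s => X ⧸ i.out.1 :=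
    { card_le := fun i => (mk_le_of_surjective (QuotientAddGroup.mk'_surjective _)).trans_eq hX
      not_cotorsion := fun i => i.out.2
      exhaustive := by
        intro C _ hC hcot
        obtain ⟨f, hf⟩ : ∃ f : μ.out → C, Function.Surjective f := by
          rw [← mk_out μ] at hC
          obtain ⟨e⟩ := (le_def _ _).1 hC
          exact ⟨Function.invFun e, Function.invFun_surjective e.injective⟩
        let φ : X →+ C := (Finsupp.linearCombination ℤ f).toAddMonoidHom
        have hφ : Function.Surjective φ := fun c => by
          obtain ⟨a, rfl⟩ := hf c
          exact ⟨Finsupp.single a 1, (Finsupp.linearCombination_single ℤ 1 a).trans (one_smul ℤ _)⟩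
        let e : (X ⧸ φ.ker) ≃+ C := QuotientAddGroup.quotientKerEquivOfSurjective φ hφ
        let K : 𝒦 := ⟨φ.ker, fun h => hcot (isCotorsion_iff_factorialSolvable.2
          ((isCotorsion_iff_factorialSolvable.1 h).of_equiv e))⟩
        obtain ⟨e'⟩ : Nonempty ((X ⧸ (Quotient.mk s K).out.1) ≃+ (X ⧸ K.1)) := Quotient.mk_out K
        exact ⟨Quotient.mk s K, ⟨e.symm.trans e'.symm⟩⟩
      irredundant := fun i j h => by
        rw [← Quotient.out_eq i, ← Quotient.out_eq j]
        exact Quotient.sound h }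
  refine ⟨Quotient s, _, inferInstance, hsys, ?_, ?_⟩
  · refine mk_quotient_le.trans ((mk_subtype_le _).trans ?_)
    have hle : #(AddSubgroup X) ≤ #(Set X) := mk_le_of_injective SetLike.coe_injective
    exact hle.trans_eq (by rw [mk_set, hX])
  · have hZ : ¬ IsCotorsion (ULift.{u} ℤ) := fun h => not_factorialSolvable_int
      ((isCotorsion_iff_factorialSolvable.1 h).of_equiv AddEquiv.ulift)
    obtain ⟨i, -⟩ := hsys.exhaustive (ULift.{u} ℤ) (by simpa using hμ) hZ
    exact ⟨i⟩

end NonCotorsion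

/-! ### Arithmetic of the cardinals `λ_i` -/

section BethSequence

variable {k : ℕ} {lam : ℕ → Cardinal.{u}}

theorem le_of_forall_succ_eq_two_power (hsucc : ∀ i, 1 ≤ i → i < k → lam (i + 1) = 2 ^ lam i)
    {i j : ℕ} (hi : 1 ≤ i) (hij : i ≤ j) (hj : j ≤ k) : lam i ≤ lam j := by
  induction j, hij using Nat.le_induction with
  | base => exact le_rfl
  | succ j hij ih =>
    rw [hsucc j (hi.trans hij) hj]
    exact (ih (Nat.le_of_succ_le hj)).trans (cantor _).le

theorem power_aleph0_eq_of_forall_succ_eq_two_power (hinf : ∀ i, 1 ≤ i → i ≤ k → ℵ₀ ≤ lam i)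
    (hone : lam 1 = lam 1 ^ ℵ₀) (hsucc : ∀ i, 1 ≤ i → i < k → lam (i + 1) = 2 ^ lam i)
    {i : ℕ} (hi : 1 ≤ i) (hik : i ≤ k) : lam i ^ ℵ₀ = lam i := by
  rcases Nat.exists_eq_add_of_le' hi with ⟨j, rfl⟩
  rcases Nat.eq_zero_or_pos j with rfl | hj
  · exact hone.symm
  · rw [hsucc j hj hik, ← power_mul, mul_aleph0_eq (hinf j hj (Nat.le_of_succ_le hik))]

/-- Coordinate `m` counts from 0 and carries `λ_{m+1}`. For `m = 0` the domain is a point; for `m =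
j + 1` the bound is `λ_{j+1} ^ λ_{j+1} = 2 ^ λ_{j+1} = λ_{j+2}`. -/
theorem mk_pi_incSeq_arrow_le (hinf : ∀ i, 1 ≤ i → i ≤ k → ℵ₀ ≤ lam i)
    (hone : lam 1 = lam 1 ^ ℵ₀) (hsucc : ∀ i, 1 ≤ i → i < k → lam (i + 1) = 2 ^ lam i)
    {C : Type u} [Nonempty C] (hC : #C ≤ lam 1) (m : Fin k) :
    #((∀ l : {l : Fin k // l < m}, IncSeq (lam ((l : Fin k) + 1))) → C) ≤ lam (m + 1) := by
  obtain ⟨_ | j, hj⟩ := m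
  · have : IsEmpty {l : Fin k // l < ⟨0, hj⟩} := ⟨fun l => Nat.not_lt_zero _ l.2⟩
    rw [mk_arrow, lift_id, lift_id,
      mk_eq_one (∀ l : {l : Fin k // l < ⟨0, hj⟩}, IncSeq (lam ((l : Fin k) + 1))), power_one]
    exact hC
  · have hjk : j + 1 ≤ k := hj.le
    have hinfj := hinf (j + 1) (Nat.le_add_left _ _) hjk
    rw [mk_arrow, lift_id, lift_id, hsucc (j + 1) (Nat.le_add_left _ _) hj,
      ← power_self_eq hinfj]
    have hA : #(∀ l : {l : Fin k // l < ⟨j + 1, hj⟩}, IncSeq (lam ((l : Fin k) + 1))) ≤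
        lam (j + 1) := by
      refine mk_pi_le_of_finite hinfj fun l => (mk_incSeq_le _).trans ?_
      have hl : (l : Fin k) + 1 ≤ j + 1 := l.2
      rw [power_aleph0_eq_of_forall_succ_eq_two_power hinf hone hsucc (Nat.le_add_left _ _)
        (hl.trans hjk)]
      exact le_of_forall_succ_eq_two_power hsucc (Nat.le_add_left _ _) hl hjk
    exact (power_le_power_right (hC.trans (le_of_forall_succ_eq_two_power hsucc le_rfl
      (Nat.le_add_left _ _) hjk))).trans (power_le_power_left (aleph0_pos.trans_le hinfj).ne' hA)

end BethSequence

/-! ### Assembly of the direct sum -/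

theorem mainTheorem3 (k : ℕ) (hk : 2 ≤ k) (lam : ℕ → Cardinal.{u})
    (hinf : ∀ i, 1 ≤ i → i ≤ k → ℵ₀ ≤ lam i)
    (hone : lam 1 = lam 1 ^ ℵ₀)
    (hsucc : ∀ i, 1 ≤ i → i < k → lam (i + 1) = 2 ^ lam i) :
    ∃ (F : Type u) (_ : AddCommGroup F),
      IsCardFree (ℵ_ (k : Ordinal.{u})) F ∧
      #F = lam k ∧
      (∀ (C : Type u) [AddCommGroup C], #C ≤ lam 1 → (IsCotorsion C ↔ ExtVanishes F C)) ∧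
      ∃ (ι : Type u) (D : ι → Type u) (_ : ∀ i, AddCommGroup (D i)),
        IsNonCotorsionSystem (lam 1) D ∧
        Nonempty (F ≃+ DirectSum ι
          (fun _ => branchGroup (fun m : Fin k => lam ((m : ℕ) + 1)))) := by
  classical
  obtain ⟨f, rfl⟩ := Nat.exists_eq_add_of_le' (one_le_two.trans hk)
  let κ : Fin (f + 1) → Cardinal.{u} := fun m => lam ((m : ℕ) + 1)
  have hκ : ∀ m, ℵ₀ ≤ κ m := fun m => hinf _ (Nat.le_add_left _ _) m.2
  have hlast := hinf (f + 1) (Nat.le_add_left _ _) le_rfl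
  have hpow : ∀ m, κ m ^ ℵ₀ ≤ lam (f + 1) := fun m => by
    rw [power_aleph0_eq_of_forall_succ_eq_two_power hinf hone hsucc (Nat.le_add_left _ _) m.2]
    exact le_of_forall_succ_eq_two_power hsucc (Nat.le_add_left _ _) m.2 le_rfl
  have hnode : lam (f + 1) ≤ #(NodeTuple κ) := le_mk_nodeTuple hκ (Fin.last f)
  have : Nonempty (NodeTuple κ) := mk_ne_zero_iff.1 (aleph0_pos.trans_le (hlast.trans hnode)).ne'
  have hG : #(branchGroup κ) = lam (f + 1) :=
    le_antisymm (mk_branchGroup_le hlast hpow) (hnode.trans mk_nodeTuple_le_mk_branchGroup)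
  have : Infinite (branchGroup κ) := infinite_iff.2 (hlast.trans_eq hG.symm)
  obtain ⟨ι, D, _, hD, hι, ⟨i₀⟩⟩ := exists_isNonCotorsionSystem
    (hinf 1 le_rfl (Nat.le_add_left _ _))
  -- Here `k ≥ 2` matters: the number of summands is at most `2 ^ λ_1 = λ_2 ≤ λ_k`.
  have hι' : #ι ≤ lam (f + 1) := by
    rw [← hsucc 1 le_rfl (by omega)] at hι
    exact hι.trans (le_of_forall_succ_eq_two_power hsucc one_le_two hk le_rfl)
  have : Nonempty ι := ⟨i₀⟩
  refine ⟨DirectSum ι fun _ => branchGroup κ, inferInstance,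
    (isCardFree_branchGroup f κ).directSum, ?_, fun C _ hC => ⟨fun h => ?_, fun h => ?_⟩,
    ι, D, inferInstance, hD, ⟨AddEquiv.refl _⟩⟩
  · rw [← mk_congr (finsuppLEquivDirectSum ℤ (branchGroup κ) ι).toEquiv, mk_finsupp_of_infinite',
      hG, max_eq_right hι']
  -- The sum embeds in a torsion-free product of copies of `ℤ`, from which vanishing of Ext is
  -- inherited.
  · let incl : (DirectSum ι fun _ => branchGroup κ) →+ ι → NodeTuple κ → ℤ :=
      { toFun := fun x i => (x i).1
        map_zero' := rfl
        map_add' := fun _ _ => rfl }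
    refine ExtVanishes.of_injective incl (fun x y hxy => DFinsupp.ext fun i => Subtype.ext ?_)
      (h _ inferInstance)
    exact congrFun hxy i
  · have hG' : ExtVanishes (branchGroup κ) C :=
      h.of_retract (DirectSum.of (fun _ => branchGroup κ) i₀)
        (DirectSum.component ℤ ι (fun _ => branchGroup κ) i₀).toAddMonoidHom
        (AddMonoidHom.ext fun x => DirectSum.of_eq_same (β := fun _ => branchGroup κ) i₀ x)
    exact (FactorialSolvable.of_extVanishes_branchGroup hκ
      (mk_pi_incSeq_arrow_le hinf hone hsucc hC) hG').isCotorsion
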